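/- For $\varepsilon\in\mathbb R$ let $W=W(\varepsilon)$ be the unital complex algebra generated by $a_+,a_-,b_+,b_-$ with relations $[a_-,a_+]=[b_-,b_+]=\varepsilon$ and $[a_\sigma,b_\tau]=0$ for all signs $\sigma,\tau$. For $s,t,u,v\ge 0$ let $S(s,t,u,v)$ be the sum, with coefficient $1$, of all distinct words with $s$ letters $a_-$, $t$ letters $a_+$, $u$ letters $b_-$ and $v$ letters $b_+$; these elements form a basis of $W$. Let $W^n$ be the span of those with $s+t+u+v=2n$. The formal trace $\mathrm{tr}:W\to W$ is the linear map which, on an element written as a totally symmetric polynomial (a combination of the $S(s,t,u,v)$) in the form $w_1a_+a_-+w_2a_-a_++w_3b_+b_-+w_4b_-b_++\cdots$ (terms collected by their last two letters, the other twelve pairs and the terms of degree less than $2$ being discarded), has the value $w_1+w_2+w_3+w_4$. Put $\Psi=\ker(\mathrm{tr})$ and $\Psi^n$ (by degree) $=\Psi\cap W^n$. Let $$J_0=\tfrac12(a_+a_--b_+b_-),\quad J_+=a_+b_-,\quad J_-=a_-b_+,\quad K_0=\tfrac12(a_+a_-+b_+b_-+\varepsilon),$$ $\mathrm{Ad}\,T(w)=[T,w]$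 and $\Delta=(\mathrm{Ad}J_0)^2+\tfrac12\mathrm{Ad}J_+\mathrm{Ad}J_-+\tfrac12\mathrm{Ad}J_-\mathrm{Ad}J_+$. For $\varepsilon=0$, where $W$ is commutative, $\frac1\varepsilon\mathrm{Ad}\,T$ denotes the limit, i.e. the Poisson bracket $w\mapsto\sum_{\chi=a,b}\left(\frac{\partial T}{\partial\chi_-}\frac{\partial w}{\partial\chi_+}-\frac{\partial T}{\partial\chi_+}\frac{\partial w}{\partial\chi_-}\right)$, and $\frac1{\varepsilon^2}\Delta$ is formed from these operators. For real $r,m$ put $$\Psi_r=\{\xi\in\Psi:\tfrac1\varepsilon\mathrm{Ad}K_0\,\xi=r\xi\},\qquad \Psi^{(m)}=\{\xi\in\Psi:\tfrac1\varepsilon\mathrm{Ad}J_0\,\xi=m\xi\}.$$ Let $\dagger$ be the conjugate-linear anti-automorphism of $W$ with $a_\pm^\dagger=a_\mp$, $b_\pm^\dagger=b_\mp$. For $R\ge0$ with $\hat R=(R^2+\tfrac14\varepsilon^2)^{1/2}>0$ let $\rho=\rho_R:W\to\Psi$ be the projection onto $\Psi$ with kernel $\{w(K_0-\hat R):w\in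 W\}$ (one has $W=\Psi\oplus\ker\rho$), let $\pi_0(\xi)$ be the coefficient of $1$ in the expansion of $\xi$ in the $S(s,t,u,v)$, and put $\langle\xi,\zeta\rangle=\pi_0(\rho(\xi^\dagger\zeta))$ and $\|\zeta\|^2=\mathrm{Re}\,\langle\zeta,\zeta\rangle$. Call $(n,r,m)\in\mathbb R^3$ admissible if $2n,\,n+r,\,n+m\in\mathbb Z$ and $|r|,|m|\le n$, and for admissible $(n,r,m)$ let $$P(n,r,m)=\left(\frac{(n+m)!}{(2n)!\,(n-m)!}\right)^{1/2}\left(\tfrac1\varepsilon\mathrm{Ad}J_-\right)^{n-m}\left(a_+^{n+r}b_-^{n-r}\right).$$ Theorem. 1. For every $\varepsilon\in\mathbb R$ the $P(n,r,m)$ with $(n,r,m)$ admissible form a basis of $\Psi$, and for each $n$ with $2n\in\mathbb Z_{\ge0}$ those with this $n$ form a basis of $\Psi\cap W^n$. 2. The coefficients of $P(n,r,m)$ in the basis $S(s,t,u,v)$ do not depend on $\varepsilon$ (and $R$ does not enter the definition). 3. For all $\varepsilon$ and $R$ as above and admissible labels, $\langle P(n_1,r_1,m_1),P(n_2,r_2,m_2)\rangle=\delta_{n_1n_2}\delta_{r_1r_2}\delta_{m_1m_2}\|P(n_1,r_1,m_1)\|^2$.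 The real number $\|P(n,r,m)\|^2$ does not depend on $m$; each of the cases positive, negative and zero occurs for some $\varepsilon,R$ and some admissible label. 4. For all $\varepsilon\in\mathbb R$ and admissible $(n,r,m)$, $$\mathrm{Ad}J_0P(n,r,m)=\varepsilon m\,P(n,r,m),\quad \mathrm{Ad}K_0P(n,r,m)=\varepsilon r\,P(n,r,m),\quad \Delta P(n,r,m)=\varepsilon^2n(n+1)P(n,r,m),$$ $$\mathrm{Ad}J_\pm P(n,r,m)=\varepsilon\,(n\mp m)^{1/2}(n\pm m+1)^{1/2}\,P(n,r,m\pm1),$$ where the right side of the last equation is $0$ if $m=\pm n$. The same equations hold for $\frac1\varepsilon\mathrm{Ad}J_0$, $\frac1\varepsilon\mathrm{Ad}K_0$, $\frac1{\varepsilon^2}\Delta$, $\frac1\varepsilon\mathrm{Ad}J_\pm$ without the factors $\varepsilon$, also for $\varepsilon=0$. 5. For all $\varepsilon\in\mathbb R$ and admissible $(n,r,m)$ the space $\Psi\cap W^n\cap\Psi_r\cap\Psi^{(m)}$ is one-dimensional and spanned by $P(n,r,m)$; for all other real $n,r,m$ it is $0$ (with $W^n=0$ unless $2n\in\mathbb Z_{\ge0}$).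 -/

import Mathlib

noncomputable section

namespace FuzzySphere

/-- The four generators `a_+`, `a_-`, `b_+`, `b_-`. -/
inductive Gen
  | ap | am | bp | bm
  deriving DecidableEq

instance : Fintype Gen := ⟨{Gen.ap, Gen.am, Gen.bp, Gen.bm}, fun g => by cases g <;> decide⟩

/-- The structure constants of the commutation relations: `[x, y] = ε * bracket x y`, that is
`[a_-, a_+] = ε`, `[b_-, b_+] = ε`, and every `a` commutes with every `b`. -/
def bracket : Gen → Gen → ℂ
  | Gen.am, Gen.ap => 1
  | Gen.ap, Gen.am => -1
  | Gen.bm, Gen.bp => 1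
  | Gen.bp, Gen.bm => -1
  | _, _ => 0

/-- The commutation relations on the free algebra. -/
inductive CommRel (ε : ℝ) : FreeAlgebra ℂ Gen → FreeAlgebra ℂ Gen → Prop
  | comm (x y : Gen) : CommRel ε
      (FreeAlgebra.ι ℂ x * FreeAlgebra.ι ℂ y - FreeAlgebra.ι ℂ y * FreeAlgebra.ι ℂ x)
      (algebraMap ℂ (FreeAlgebra ℂ Gen) ((ε : ℂ) * bracket x y))

/-- The algebra `W(ε)`, the product of two Heisenberg-Weil algebras. -/
abbrev W (ε : ℝ) : Type := RingQuot (CommRel ε)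

/-- The quotient map from the free algebra to `W(ε)`. -/
def toW (ε : ℝ) : FreeAlgebra ℂ Gen →ₐ[ℂ] W ε := RingQuot.mkAlgHom ℂ (CommRel ε)

/-- A generator as an element of `W(ε)`. -/
def gen (ε : ℝ) (g : Gen) : W ε := toW ε (FreeAlgebra.ι ℂ g)

lemma gen_comm (ε : ℝ) (x y : Gen) :
    gen ε x * gen ε y - gen ε y * gen ε x = algebraMap ℂ (W ε) ((ε : ℂ) * bracket x y) := by
  have h := RingQuot.mkAlgHom_rel ℂ (CommRel.comm (ε := ε) x y)
  simpa [gen, toW] using h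

/-- The algebra morphism out of `W(ε)` given by images of the generators which satisfy the
commutation relations. -/
def liftW (ε : ℝ) {B : Type} [Ring B] [Algebra ℂ B] (f : Gen → B)
    (hf : ∀ x y, f x * f y - f y * f x = algebraMap ℂ B ((ε : ℂ) * bracket x y)) :
    W ε →ₐ[ℂ] B :=
  RingQuot.liftAlgHom ℂ ⟨FreeAlgebra.lift ℂ f, by
    rintro _ _ ⟨x, y⟩
    simp only [map_sub, map_mul, FreeAlgebra.lift_ι_apply, AlgHom.commutes]
    simpa using hf x y⟩

lemma liftW_toW (ε : ℝ) {B : Type} [Ring B] [Algebra ℂ B] (f : Gen → B)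
    (hf : ∀ x y, f x * f y - f y * f x = algebraMap ℂ B ((ε : ℂ) * bracket x y))
    (u : FreeAlgebra ℂ Gen) : liftW ε f hf (toW ε u) = FreeAlgebra.lift ℂ f u := by
  simp [liftW, toW]

lemma liftW_gen (ε : ℝ) {B : Type} [Ring B] [Algebra ℂ B] (f : Gen → B)
    (hf : ∀ x y, f x * f y - f y * f x = algebraMap ℂ B ((ε : ℂ) * bracket x y)) (g : Gen) :
    liftW ε f hf (gen ε g) = f g := by
  simp [gen, liftW_toW]

/-- The product of the letters of a word, in the free algebra. -/
def wordF (l : List Gen) : FreeAlgebra ℂ Gen := (l.map (FreeAlgebra.ι ℂ)).prod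

/-- The finite set of all distinct words with a given multiset of letters. -/
def words (s : Multiset Gen) : Finset (List Gen) := s.lists.toFinset

lemma mem_words {s : Multiset Gen} {l : List Gen} : l ∈ words s ↔ (l : Multiset Gen) = s := by
  simp [words, eq_comm]

/-- The totally symmetric polynomial `S(s)` with each term a permutation of the letters in `s`
and having coefficient 1, in the free algebra. -/
def symF (s : Multiset Gen) : FreeAlgebra ℂ Gen := ∑ l ∈ words s, wordF l

/-- The totally symmetric homogeneous polynomial `S(s)` as an element of `W(ε)`. -/
def S (ε : ℝ) (s : Multiset Gen) : W ε := toW ε (symF s)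

/-- Products of words as elements of `W(ε)`. -/
def wordW (ε : ℝ) (l : List Gen) : W ε := toW ε (wordF l)

lemma wordW_nil (ε : ℝ) : wordW ε [] = 1 := by simp [wordW, wordF]

lemma wordW_cons (ε : ℝ) (g : Gen) (l : List Gen) : wordW ε (g :: l) = gen ε g * wordW ε l := by
  simp [wordW, wordF, gen]

lemma S_eq (ε : ℝ) (s : Multiset Gen) : S ε s = ∑ l ∈ words s, wordW ε l := by
  simp [S, symF, wordW]

/-- A word-sum is a sum over the first letter. -/
lemma sum_words {M : Type*} [AddCommMonoid M] (s : Multiset Gen) (hs : s ≠ 0)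
    (f : List Gen → M) :
    ∑ l ∈ words s, f l = ∑ g ∈ s.toFinset, ∑ l ∈ words (s.erase g), f (g :: l) := by
  rw [Finset.sum_sigma']
  symm
  refine Finset.sum_bij (fun p _ => p.1 :: p.2) ?_ ?_ ?_ ?_
  · rintro ⟨g, l⟩ h
    simp only [Finset.mem_sigma, Multiset.mem_toFinset, mem_words] at h ⊢
    rw [← Multiset.cons_coe, h.2, Multiset.cons_erase h.1]
  · rintro ⟨g, l⟩ _ ⟨g', l'⟩ _ h
    simp only [List.cons.injEq] at h
    obtain ⟨rfl, rfl⟩ := h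
    rfl
  · intro l hl
    rw [mem_words] at hl
    cases l with
    | nil => exact absurd hl.symm hs
    | cons g l =>
      refine ⟨⟨g, l⟩, ?_, rfl⟩
      simp only [Finset.mem_sigma, Multiset.mem_toFinset, mem_words]
      subst hl
      simp
  · intros; rfl

/-- The number of distinct words with a given multiset of letters. -/
def nWords (s : Multiset Gen) : ℕ := (words s).card

lemma nWords_eq_sum (s : Multiset Gen) (hs : s ≠ 0) :
    nWords s = ∑ g ∈ s.toFinset, nWords (s.erase g) := by
  have := sum_words s hs (fun _ => (1 : ℕ))
  simpa [nWords] using this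

lemma prod_fact_erase {s : Multiset Gen} {g : Gen} (hg : g ∈ s) :
    ∏ x, (s.count x).factorial = s.count g * ∏ x, ((s.erase g).count x).factorial := by
  rw [← Finset.mul_prod_erase _ _ (Finset.mem_univ g),
    ← Finset.mul_prod_erase _ (fun x => ((s.erase g).count x).factorial) (Finset.mem_univ g)]
  rw [← mul_assoc]
  congr 1
  · rw [Multiset.count_erase_self]
    exact (Nat.mul_factorial_pred (Multiset.count_pos.2 hg).ne').symm
  · refine Finset.prod_congr rfl fun x hx => ?_
    rw [Multiset.count_erase_of_ne (Finset.ne_of_mem_erase hx)]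

/-- The multinomial formula. -/
lemma nWords_mul (s : Multiset Gen) :
    nWords s * ∏ x, (s.count x).factorial = s.card.factorial := by
  induction h : s.card generalizing s with
  | zero =>
    rw [Multiset.card_eq_zero] at h
    subst h
    have : words 0 = {[]} := by
      ext l; simp [mem_words]
    simp [nWords, this]
  | succ n ih =>
    have hs : s ≠ 0 := by rintro rfl; simp at h
    rw [nWords_eq_sum s hs, Finset.sum_mul]
    have : ∀ g ∈ s.toFinset, nWords (s.erase g) * ∏ x, (s.count x).factorial
        = s.count g * n.factorial := by
      intro g hg
      rw [Multiset.mem_toFinset] at hg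
      rw [prod_fact_erase hg, ← ih (s.erase g) (by rw [Multiset.card_erase_of_mem hg, h]; rfl)]
      ring
    rw [Finset.sum_congr rfl this, ← Finset.sum_mul, Multiset.toFinset_sum_count_eq, h,
      Nat.factorial_succ]

lemma nWords_pos (s : Multiset Gen) : 0 < nWords s := by
  rcases Nat.eq_zero_or_pos (nWords s) with h | h
  · have := nWords_mul s
    rw [h, zero_mul] at this
    exact absurd this.symm (Nat.factorial_ne_zero _)
  · exact h

lemma nWords_erase {s : Multiset Gen} {g : Gen} (hg : g ∈ s) :
    s.card * nWords (s.erase g) = s.count g * nWords s := by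
  have h1 := nWords_mul s
  have h2 := nWords_mul (s.erase g)
  rw [prod_fact_erase hg] at h1
  have hp : 0 < ∏ x, ((s.erase g).count x).factorial :=
    Finset.prod_pos fun x _ => Nat.factorial_pos _
  have hc : s.card = (s.erase g).card + 1 := by
    rw [Multiset.card_erase_of_mem hg]
    exact (Nat.succ_pred_eq_of_pos (Multiset.card_pos_iff_exists_mem.2 ⟨g, hg⟩)).symm
  apply Nat.eq_of_mul_eq_mul_right hp
  rw [mul_assoc, h2]
  have h3 : s.card.factorial = s.card * (s.erase g).card.factorial := by
    rw [hc, Nat.factorial_succ]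
  rw [← h3, ← h1]
  ring

/-! ### The symmetric polynomials span -/

/-- The span of all words with fewer than `N` letters. -/
def shortSpan (ε : ℝ) (N : ℕ) : Submodule ℂ (W ε) :=
  Submodule.span ℂ (wordW ε '' {l | l.length < N})

lemma wordW_mem_shortSpan {ε : ℝ} {N : ℕ} {l : List Gen} (h : l.length < N) :
    wordW ε l ∈ shortSpan ε N := Submodule.subset_span ⟨l, h, rfl⟩

lemma gen_mul_mem_shortSpan {ε : ℝ} {N : ℕ} (g : Gen) {w : W ε} (h : w ∈ shortSpan ε N) :
    gen ε g * w ∈ shortSpan ε (N + 1) := by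
  induction h using Submodule.span_induction with
  | mem w hw =>
    obtain ⟨l, hl, rfl⟩ := hw
    rw [← wordW_cons]
    exact wordW_mem_shortSpan (by simpa using hl)
  | zero => simp
  | add x y _ _ hx hy => rw [mul_add]; exact Submodule.add_mem _ hx hy
  | smul c x _ hx => rw [mul_smul_comm]; exact Submodule.smul_mem _ c hx

lemma perm_sub_mem {ε : ℝ} {l l' : List Gen} (h : l.Perm l') :
    wordW ε l - wordW ε l' ∈ shortSpan ε l.length := by
  induction h with
  | nil => simp
  | cons x _ ih =>
    rw [wordW_cons, wordW_cons, ← mul_sub]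
    exact gen_mul_mem_shortSpan x ih
  | swap x y l =>
    rw [wordW_cons, wordW_cons, wordW_cons, wordW_cons, ← mul_assoc, ← mul_assoc, ← sub_mul,
      gen_comm, ← Algebra.smul_def]
    exact Submodule.smul_mem _ _ (wordW_mem_shortSpan (by simp))
  | trans h1 h2 ih1 ih2 =>
    rw [← h1.length_eq] at ih2
    simpa using Submodule.add_mem _ ih1 ih2

lemma wordW_mem_span (ε : ℝ) (n : ℕ) (l : List Gen) (hl : l.length = n) :
    wordW ε l ∈ Submodule.span ℂ (S ε '' {s | s.card ≤ n}) := by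
  induction n using Nat.strong_induction_on generalizing l with
  | _ n ih =>
    have hle : shortSpan ε n ≤ Submodule.span ℂ (S ε '' {s | s.card ≤ n}) := by
      refine Submodule.span_le.2 ?_
      rintro _ ⟨l', hl', rfl⟩
      refine Submodule.span_mono (Set.image_mono ?_) (ih l'.length hl' l' rfl)
      intro s hs
      exact le_trans hs (show l'.length < n from hl').le
    have h1 : S ε (l : Multiset Gen) - (nWords l : ℂ) • wordW ε l ∈ shortSpan ε n := by
      have : S ε (l : Multiset Gen) - (nWords l : ℂ) • wordW ε l
          = ∑ l' ∈ words l, (wordW ε l' - wordW ε l) := by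
        rw [S_eq, Finset.sum_sub_distrib, Finset.sum_const, nWords, Nat.cast_smul_eq_nsmul]
      rw [this]
      refine Submodule.sum_mem _ fun l' hl' => ?_
      have hp : l'.Perm l := Multiset.coe_eq_coe.1 (mem_words.1 hl')
      have := perm_sub_mem (ε := ε) hp
      rwa [hp.length_eq, hl] at this
    have h2 : S ε (l : Multiset Gen) ∈ Submodule.span ℂ (S ε '' {s | s.card ≤ n}) :=
      Submodule.subset_span ⟨_, by simp [hl], rfl⟩
    have h3 := Submodule.sub_mem _ h2 (hle h1)
    rw [sub_sub_cancel] at h3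
    have hne : (nWords l : ℂ) ≠ 0 := Nat.cast_ne_zero.2 (nWords_pos _).ne'
    have h4 := Submodule.smul_mem _ (nWords l : ℂ)⁻¹ h3
    rwa [smul_smul, inv_mul_cancel₀ hne, one_smul] at h4

lemma basisFreeMonoid_apply (l : FreeMonoid Gen) :
    FreeAlgebra.basisFreeMonoid ℂ Gen l = wordF l.toList := by
  simp [FreeAlgebra.basisFreeMonoid, FreeAlgebra.equivMonoidAlgebraFreeMonoid, wordF,
    FreeMonoid.lift_apply]

lemma span_wordF : Submodule.span ℂ (Set.range wordF) = ⊤ := by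
  rw [← (FreeAlgebra.basisFreeMonoid ℂ Gen).span_eq]
  congr 1
  ext u
  constructor
  · rintro ⟨l, rfl⟩
    exact ⟨FreeMonoid.ofList l, by rw [basisFreeMonoid_apply]; rfl⟩
  · rintro ⟨l, rfl⟩
    exact ⟨l.toList, by rw [basisFreeMonoid_apply]⟩

lemma toW_surjective (ε : ℝ) : Function.Surjective (toW ε) :=
  RingQuot.mkAlgHom_surjective ℂ (CommRel ε)

lemma span_S (ε : ℝ) : ⊤ ≤ Submodule.span ℂ (Set.range (S ε)) := by
  intro w _
  obtain ⟨u, rfl⟩ := toW_surjective ε w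
  have hu : u ∈ Submodule.span ℂ (Set.range wordF) := by rw [span_wordF]; trivial
  induction hu using Submodule.span_induction with
  | mem x hx =>
    obtain ⟨l, rfl⟩ := hx
    exact Submodule.span_mono (Set.image_subset_range _ _) (wordW_mem_span ε l.length l rfl)
  | zero => simp
  | add x y _ _ hx hy => rw [map_add]; exact Submodule.add_mem _ (hx trivial) (hy trivial)
  | smul c x _ hx => rw [map_smul]; exact Submodule.smul_mem _ c (hx trivial)

/-! ### The symbol map and linear independence of the symmetric polynomials -/

/-- The derivation `∑ y, bracket x y * ∂/∂y` of the commutative polynomials. -/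
def symD (x : Gen) : Derivation ℂ (MvPolynomial Gen ℂ) (MvPolynomial Gen ℂ) :=
  ∑ y, bracket x y • MvPolynomial.pderiv y

lemma symD_apply (x : Gen) (p : MvPolynomial Gen ℂ) :
    symD x p = ∑ y, bracket x y • MvPolynomial.pderiv y p := by
  have h := map_sum (Derivation.coeFnAddMonoidHom :
    Derivation ℂ (MvPolynomial Gen ℂ) (MvPolynomial Gen ℂ) →+ _)
    (fun y => bracket x y • MvPolynomial.pderiv y) Finset.univ
  have h' := congrFun h p
  rw [Finset.sum_apply] at h'
  exact h'

lemma symD_X (x y : Gen) :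
    symD x (MvPolynomial.X y) = algebraMap ℂ (MvPolynomial Gen ℂ) (bracket x y) := by
  rw [symD_apply, Finset.sum_eq_single y]
  · rw [MvPolynomial.pderiv_X_self, Algebra.algebraMap_eq_smul_one]
  · intro z _ hz
    rw [MvPolynomial.pderiv_X_of_ne hz.symm, smul_zero]
  · simp

lemma pderiv_symm (x y : Gen) (p : MvPolynomial Gen ℂ) :
    MvPolynomial.pderiv x (MvPolynomial.pderiv y p)
      = MvPolynomial.pderiv y (MvPolynomial.pderiv x p) := by
  have h : ⁅(MvPolynomial.pderiv x : Derivation ℂ (MvPolynomial Gen ℂ) (MvPolynomial Gen ℂ)),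
      (MvPolynomial.pderiv y : Derivation ℂ (MvPolynomial Gen ℂ) (MvPolynomial Gen ℂ))⁆ = 0 := by
    refine MvPolynomial.derivation_ext fun z => ?_
    rw [Derivation.commutator_apply, MvPolynomial.pderiv_X, MvPolynomial.pderiv_X]
    by_cases h1 : x = z <;> by_cases h2 : y = z <;> simp [h1, h2]
  have := congrArg (fun d => d p) h
  simp only [Derivation.commutator_apply] at this
  exact sub_eq_zero.1 this

lemma symD_comm (x y : Gen) (p : MvPolynomial Gen ℂ) :
    symD x (symD y p) = symD y (symD x p) := by
  have h : ⁅symD x, symD y⁆ = 0 := by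
    refine MvPolynomial.derivation_ext fun z => ?_
    rw [Derivation.commutator_apply, symD_X, symD_X]
    simp
  have := congrArg (fun d => d p) h
  simp only [Derivation.commutator_apply] at this
  exact sub_eq_zero.1 this

lemma bracket_antisymm (x y : Gen) : bracket x y = - bracket y x := by
  cases x <;> cases y <;> simp [bracket]

/-- The operator `x + c * symD x` on commutative polynomials. -/
def opM (c : ℂ) (x : Gen) : Module.End ℂ (MvPolynomial Gen ℂ) :=
  LinearMap.mulLeft ℂ (MvPolynomial.X x) + c • (symD x : MvPolynomial Gen ℂ →ₗ[ℂ] _)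

lemma opM_apply (c : ℂ) (x : Gen) (p : MvPolynomial Gen ℂ) :
    opM c x p = MvPolynomial.X x * p + c • symD x p := by
  simp [opM]

lemma opM_comm (c d : ℂ) (x y : Gen) :
    opM c x * opM d y - opM d y * opM c x
      = algebraMap ℂ (Module.End ℂ (MvPolynomial Gen ℂ)) ((c + d) * bracket x y) := by
  refine LinearMap.ext fun p => ?_
  rw [Module.algebraMap_end_apply, LinearMap.sub_apply, Module.End.mul_apply,
    Module.End.mul_apply]
  simp only [opM_apply, map_add, Derivation.leibniz, Derivation.map_smul, symD_X, smul_eq_mul,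
    symD_comm y x]
  rw [bracket_antisymm y x]
  simp only [Algebra.smul_def, map_mul, map_add, map_neg]
  ring

/-- The representation of `W(ε)` on commutative polynomials. -/
def rep (ε : ℝ) : W ε →ₐ[ℂ] Module.End ℂ (MvPolynomial Gen ℂ) :=
  liftW ε (opM (ε / 2)) fun x y => by rw [opM_comm]; congr 1; ring

lemma rep_gen (ε : ℝ) (g : Gen) : rep ε (gen ε g) = opM (ε / 2) g := liftW_gen _ _ _ _

/-- The (Weyl) symbol of an element of `W(ε)`. -/
def symbol (ε : ℝ) : W ε →ₗ[ℂ] MvPolynomial Gen ℂ :=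
  (LinearMap.applyₗ (1 : MvPolynomial Gen ℂ)) ∘ₗ (rep ε).toLinearMap

lemma symbol_apply (ε : ℝ) (w : W ε) : symbol ε w = rep ε w 1 := rfl

lemma symbol_gen_mul (ε : ℝ) (g : Gen) (w : W ε) :
    symbol ε (gen ε g * w) = opM (ε / 2) g (symbol ε w) := by
  simp [symbol_apply, rep_gen]

lemma rep_commute (ε : ℝ) (g : Gen) (w : W ε) (p : MvPolynomial Gen ℂ) :
    rep ε w (opM (-(ε / 2)) g p) = opM (-(ε / 2)) g (rep ε w p) := by
  obtain ⟨u, rfl⟩ := toW_surjective ε w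
  induction u using FreeAlgebra.induction generalizing p with
  | grade0 r => simp [Module.algebraMap_end_apply]
  | grade1 x =>
    have h := opM_comm (ε / 2) (-(ε / 2)) x g
    have h' := congrArg (fun f => f p) h
    simp only [add_neg_cancel, zero_mul, map_zero, LinearMap.sub_apply, Module.End.mul_apply,
      LinearMap.zero_apply] at h'
    change rep ε (gen ε x) _ = opM (-(ε / 2)) g (rep ε (gen ε x) p)
    rw [rep_gen]
    exact sub_eq_zero.1 h'
  | mul a b ha hb => simp only [map_mul, Module.End.mul_apply, ha, hb]
  | add a b ha hb => simp only [map_add, LinearMap.add_apply, ha, hb]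

lemma symbol_mul_gen (ε : ℝ) (g : Gen) (w : W ε) :
    symbol ε (w * gen ε g) = opM (-(ε / 2)) g (symbol ε w) := by
  have h : rep ε (gen ε g) 1 = opM (-(ε / 2)) g 1 := by
    rw [rep_gen, opM_apply, opM_apply]; simp
  rw [symbol_apply, map_mul, Module.End.mul_apply, h, rep_commute, symbol_apply]

/-- The monomial with a given multiset of letters. -/
def mon (s : Multiset Gen) : MvPolynomial Gen ℂ :=
  MvPolynomial.monomial (Multiset.toFinsupp s) 1

lemma X_mul_mon (g : Gen) (s : Multiset Gen) : MvPolynomial.X g * mon s = mon (g ::ₘ s) := by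
  rw [mon, mon, MvPolynomial.X, MvPolynomial.monomial_mul, ← Multiset.singleton_add, map_add,
    Multiset.toFinsupp_singleton, one_mul]

lemma pderiv_mon (g : Gen) (s : Multiset Gen) :
    MvPolynomial.pderiv g (mon s) = (s.count g : ℂ) • mon (s.erase g) := by
  have key : Multiset.toFinsupp s - Finsupp.single g 1 = Multiset.toFinsupp (s.erase g) := by
    ext x
    by_cases h : x = g
    · subst h; simp
    · simp [Multiset.count_erase_of_ne h, Ne.symm h]
  rw [mon, MvPolynomial.pderiv_monomial, mon, MvPolynomial.smul_monomial, key]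
  simp only [Multiset.toFinsupp_apply, one_mul, smul_eq_mul, mul_one]

lemma symbol_S (ε : ℝ) (s : Multiset Gen) : symbol ε (S ε s) = (nWords s : ℂ) • mon s := by
  induction h : s.card generalizing s with
  | zero =>
    rw [Multiset.card_eq_zero] at h
    subst h
    have : words 0 = {[]} := by
      ext l; simp [mem_words]
    simp [S_eq, nWords, this, wordW_nil, symbol_apply, mon]
  | succ n ih =>
    have hs : s ≠ 0 := by rintro rfl; simp at h
    have h1 : S ε s = ∑ g ∈ s.toFinset, gen ε g * S ε (s.erase g) := by
      rw [S_eq, sum_words s hs]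
      refine Finset.sum_congr rfl fun g _ => ?_
      rw [S_eq, Finset.mul_sum]
      simp only [wordW_cons]
    have h2 : ∀ g ∈ s.toFinset, symbol ε (gen ε g * S ε (s.erase g))
        = (nWords (s.erase g) : ℂ) • mon s
          + ((ε / 2 : ℂ) * nWords (s.erase g)) • symD g (mon (s.erase g)) := by
      intro g hg
      rw [Multiset.mem_toFinset] at hg
      rw [symbol_gen_mul, ih (s.erase g) (by rw [Multiset.card_erase_of_mem hg, h]; rfl),
        map_smul, opM_apply, X_mul_mon, Multiset.cons_erase hg, smul_add, smul_smul, mul_comm]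
    rw [h1, map_sum, Finset.sum_congr rfl h2, Finset.sum_add_distrib, ← Finset.sum_smul,
      nWords_eq_sum s hs]
    push_cast
    rw [add_eq_left]
    -- the first-order terms cancel by antisymmetry of the bracket
    have hcard : (s.card : ℂ) ≠ 0 := by rw [h]; exact_mod_cast Nat.succ_ne_zero n
    have h3 : ∀ g ∈ s.toFinset,
        ((ε / 2 : ℂ) * nWords (s.erase g)) • symD g (mon (s.erase g))
          = ∑ y, (bracket g y * ((ε / 2 : ℂ) * (nWords s / s.card)
              * (s.count g * (s.erase g).count y))) • mon ((s.erase g).erase y) := by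
      intro g hg
      rw [Multiset.mem_toFinset] at hg
      rw [symD_apply, Finset.smul_sum]
      refine Finset.sum_congr rfl fun y _ => ?_
      rw [pderiv_mon, smul_smul, smul_smul]
      congr 1
      have := nWords_erase hg
      have h4 : (s.card : ℂ) * nWords (s.erase g) = s.count g * nWords s := by
        exact_mod_cast this
      have h5 : (nWords (s.erase g) : ℂ) = s.count g * nWords s / s.card := by
        rw [← h4]; field_simp
      rw [h5]; ring
    rw [Finset.sum_congr rfl h3]
    have h6 : ∑ g ∈ s.toFinset, ∑ y, (bracket g y * ((ε / 2 : ℂ) * (nWords s / s.card)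
              * (s.count g * (s.erase g).count y))) • mon ((s.erase g).erase y)
        = ∑ g, ∑ y, (bracket g y * ((ε / 2 : ℂ) * (nWords s / s.card)
              * (s.count g * (s.erase g).count y))) • mon ((s.erase g).erase y) := by
      refine Finset.sum_subset (Finset.subset_univ _) fun g _ hg => ?_
      rw [Multiset.mem_toFinset] at hg
      simp [Multiset.count_eq_zero_of_notMem hg]
    rw [h6]
    have h7 : ∀ A : MvPolynomial Gen ℂ, A = -A → A = 0 := fun A hA => by
      have : (2 : ℂ) • A = 0 := by rw [two_smul]; nth_rewrite 2 [hA]; simp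
      exact (smul_eq_zero.1 this).resolve_left two_ne_zero
    apply h7
    conv_lhs => rw [Finset.sum_comm]
    simp only [← Finset.sum_neg_distrib]
    refine Finset.sum_congr rfl fun g _ => Finset.sum_congr rfl fun y _ => ?_
    rw [bracket_antisymm y g, Multiset.erase_comm s y g, ← neg_smul]
    congr 1
    by_cases hgy : g = y
    · subst hgy; ring
    · rw [Multiset.count_erase_of_ne hgy, Multiset.count_erase_of_ne (Ne.symm hgy)]; ring

lemma linearIndependent_symbol_S (ε : ℝ) :
    LinearIndependent ℂ (fun s => symbol ε (S ε s)) := by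
  have h1 : LinearIndependent ℂ mon := by
    have := (MvPolynomial.basisMonomials Gen ℂ).linearIndependent.comp
      (Multiset.toFinsupp : Multiset Gen ≃+ (Gen →₀ ℕ)) (AddEquiv.injective _)
    have h : mon = MvPolynomial.basisMonomials Gen ℂ ∘ Multiset.toFinsupp := by
      ext1 s
      simp [mon]
    rw [h]
    exact this
  have h2 := h1.units_smul fun s => Units.mk0 (nWords s : ℂ) (Nat.cast_ne_zero.2 (nWords_pos s).ne')
  convert h2 using 1
  ext1 s
  simp [symbol_S, Units.smul_def]

lemma linearIndependent_S (ε : ℝ) : LinearIndependent ℂ (S ε) :=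
  LinearIndependent.of_comp (symbol ε) (linearIndependent_symbol_S ε)

/-- The basis of `W(ε)` given by the symmetric polynomials `S(s)`. -/
def symBasis (ε : ℝ) : Module.Basis (Multiset Gen) ℂ (W ε) :=
  Module.Basis.mk (linearIndependent_S ε) (span_S ε)

lemma symBasis_apply (ε : ℝ) (s : Multiset Gen) : symBasis ε s = S ε s := by
  simp [symBasis]

/-- The space `W^n` of symmetric homogeneous polynomials of degree `2n`. -/
def Wn (ε : ℝ) (n : ℝ) : Submodule ℂ (W ε) :=
  Submodule.span ℂ (S ε '' {s | (s.card : ℝ) = 2 * n})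

/-! ### The formal trace -/

/-- The action of the formal trace on one word: a word which ends in one of `a_+ a_-`, `a_- a_+`,
`b_+ b_-`, `b_- b_+` is stripped of these last two letters, any other word is sent to zero. -/
def stripWord (l : List Gen) : FreeAlgebra ℂ Gen :=
  match l.reverse with
  | Gen.am :: Gen.ap :: t => wordF t.reverse
  | Gen.ap :: Gen.am :: t => wordF t.reverse
  | Gen.bm :: Gen.bp :: t => wordF t.reverse
  | Gen.bp :: Gen.bm :: t => wordF t.reverse
  | _ => 0

/-- The linear extension of `stripWord` to the free algebra, whose basis are the words. -/
def strip : FreeAlgebra ℂ Gen →ₗ[ℂ] FreeAlgebra ℂ Gen :=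
  (FreeAlgebra.basisFreeMonoid ℂ Gen).constr ℂ fun l => stripWord l.toList

/-- The formal trace `tr`: an element is written as a totally symmetric polynomial
`w = w₁ a_+ a_- + w₂ a_- a_+ + w₃ b_+ b_- + w₄ b_- b_+ + ⋯` and is sent to
`w₁ + w₂ + w₃ + w₄`. -/
def tr (ε : ℝ) : W ε →ₗ[ℂ] W ε :=
  (symBasis ε).constr ℂ fun s => toW ε (strip (symF s))

/-- The space `Ψ` of formally traceless symmetric polynomials. -/
def Psi (ε : ℝ) : Submodule ℂ (W ε) := LinearMap.ker (tr ε)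

lemma strip_wordF (l : List Gen) : strip (wordF l) = stripWord l := by
  have := (FreeAlgebra.basisFreeMonoid ℂ Gen).constr_basis ℂ (fun l => stripWord l.toList)
    (FreeMonoid.ofList l)
  rwa [basisFreeMonoid_apply] at this

lemma sum_words_reverse {M : Type*} [AddCommMonoid M] (s : Multiset Gen) (f : List Gen → M) :
    ∑ l ∈ words s, f l.reverse = ∑ l ∈ words s, f l := by
  refine Finset.sum_bij (fun l _ => l.reverse) ?_ ?_ ?_ ?_
  · intro l hl
    rw [mem_words] at hl ⊢
    rw [← hl]
    exact Multiset.coe_eq_coe.2 l.reverse_perm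
  · intro l _ l' _ h
    exact List.reverse_injective h
  · intro l hl
    refine ⟨l.reverse, ?_, by simp⟩
    rw [mem_words] at hl ⊢
    rw [← hl]
    exact Multiset.coe_eq_coe.2 l.reverse_perm
  · intros; rfl

lemma stripWord_reverse (x y : Gen) (t : List Gen) :
    stripWord (x :: y :: t).reverse = if bracket x y = 0 then 0 else wordF t.reverse := by
  cases x <;> cases y <;> simp [stripWord, bracket, -List.reverse_cons]

lemma tr_S (ε : ℝ) (s : Multiset Gen) :
    tr ε (S ε s) = ∑ l ∈ words s, toW ε (stripWord l.reverse) := by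
  rw [← symBasis_apply, tr, Module.Basis.constr_basis, symF, map_sum, map_sum,
    sum_words_reverse s (fun l => toW ε (stripWord l))]
  simp only [strip_wordF]

lemma tr_S_of_card_lt (ε : ℝ) {s : Multiset Gen} (hs : s.card < 2) : tr ε (S ε s) = 0 := by
  rw [tr_S]
  refine Finset.sum_eq_zero fun l hl => ?_
  rw [mem_words] at hl
  subst hl
  match l, hs with
  | [], _ => simp [stripWord]
  | [x], _ => cases x <;> simp [stripWord]

/-- The formal trace of a basis element is a sum over contractions of two letters. -/
lemma tr_S_of_le_card (ε : ℝ) {s : Multiset Gen} (hs : 2 ≤ s.card) :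
    tr ε (S ε s) = ∑ x ∈ s.toFinset, ∑ y ∈ (s.erase x).toFinset,
      if bracket x y = 0 then 0 else S ε ((s.erase x).erase y) := by
  rw [tr_S, sum_words s (by rintro rfl; simp at hs)]
  refine Finset.sum_congr rfl fun x hx => ?_
  rw [Multiset.mem_toFinset] at hx
  rw [sum_words (s.erase x) (by
    intro h
    have := congrArg Multiset.card h
    rw [Multiset.card_erase_of_mem hx, Multiset.card_zero] at this
    have h2 := Nat.pred_eq_sub_one (n := s.card)
    omega)]
  refine Finset.sum_congr rfl fun y _ => ?_
  simp only [stripWord_reverse]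
  split_ifs with h
  · simp
  · rw [S_eq, ← sum_words_reverse _ (wordW ε)]
    rfl

/-! ### The kernel of the trace in terms of symbols -/

/-- The operator `∂_{a_+} ∂_{a_-} + ∂_{b_+} ∂_{b_-}`. -/
def lap : MvPolynomial Gen ℂ →ₗ[ℂ] MvPolynomial Gen ℂ :=
  (MvPolynomial.pderiv (R := ℂ) Gen.ap).toLinearMap ∘ₗ
    (MvPolynomial.pderiv (R := ℂ) Gen.am).toLinearMap +
  (MvPolynomial.pderiv (R := ℂ) Gen.bp).toLinearMap ∘ₗ
    (MvPolynomial.pderiv (R := ℂ) Gen.bm).toLinearMap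

lemma lap_apply (p : MvPolynomial Gen ℂ) :
    lap p = MvPolynomial.pderiv Gen.ap (MvPolynomial.pderiv Gen.am p)
      + MvPolynomial.pderiv Gen.bp (MvPolynomial.pderiv Gen.bm p) := rfl

lemma sum_gen {M : Type*} [AddCommMonoid M] (f : Gen → M) :
    ∑ g, f g = f Gen.ap + (f Gen.am + (f Gen.bp + f Gen.bm)) := by
  have : (Finset.univ : Finset Gen) = {Gen.ap, Gen.am, Gen.bp, Gen.bm} := rfl
  rw [this]
  simp

lemma two_lap (p : MvPolynomial Gen ℂ) :
    (2 : ℂ) • lap p = ∑ x, ∑ y, if bracket x y = 0 then 0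
      else MvPolynomial.pderiv y (MvPolynomial.pderiv x p) := by
  simp only [sum_gen, bracket, lap_apply, two_smul]
  simp only [one_ne_zero, neg_eq_zero, if_true, if_false, zero_add, add_zero]
  rw [pderiv_symm Gen.am Gen.ap, pderiv_symm Gen.bm Gen.bp]
  abel

/-- Rescaling of each homogeneous component of degree `k` by `(k + 2) (k + 1)`. -/
def rescale : MvPolynomial Gen ℂ →ₗ[ℂ] MvPolynomial Gen ℂ :=
  (MvPolynomial.basisMonomials Gen ℂ).constr ℂ fun d =>
    (((d.degree + 2) * (d.degree + 1) : ℕ) : ℂ) • MvPolynomial.monomial d 1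

lemma rescale_monomial (d : Gen →₀ ℕ) (c : ℂ) : rescale (MvPolynomial.monomial d c)
    = (((d.degree + 2) * (d.degree + 1) : ℕ) : ℂ) • MvPolynomial.monomial d c := by
  have := (MvPolynomial.basisMonomials Gen ℂ).constr_basis ℂ (fun d =>
    (((d.degree + 2) * (d.degree + 1) : ℕ) : ℂ) • (MvPolynomial.monomial d (1 : ℂ))) d
  rw [MvPolynomial.coe_basisMonomials] at this
  have h : MvPolynomial.monomial d c = c • MvPolynomial.monomial d (1 : ℂ) := by
    rw [MvPolynomial.smul_monomial, smul_eq_mul, mul_one]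
  rw [h, map_smul, rescale, this, smul_comm]

lemma coeff_rescale (d : Gen →₀ ℕ) (p : MvPolynomial Gen ℂ) :
    MvPolynomial.coeff d (rescale p)
      = (((d.degree + 2) * (d.degree + 1) : ℕ) : ℂ) * MvPolynomial.coeff d p := by
  induction p using MvPolynomial.induction_on' with
  | monomial n a =>
    rw [rescale_monomial, MvPolynomial.coeff_smul, smul_eq_mul, MvPolynomial.coeff_monomial]
    split_ifs with h
    · rw [h]
    · simp
  | add p q hp hq => rw [map_add, MvPolynomial.coeff_add, hp, hq, MvPolynomial.coeff_add,
    mul_add (((d.degree + 2) * (d.degree + 1) : ℕ) : ℂ)]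

lemma rescale_eq_zero {p : MvPolynomial Gen ℂ} (h : rescale p = 0) : p = 0 := by
  ext d
  have := coeff_rescale d p
  rw [h, MvPolynomial.coeff_zero] at this
  have h2 : (((d.degree + 2) * (d.degree + 1) : ℕ) : ℂ) ≠ 0 := by
    exact Nat.cast_ne_zero.2 (by positivity)
  rw [MvPolynomial.coeff_zero]
  exact (mul_eq_zero.1 this.symm).resolve_left h2

lemma degree_toFinsupp (s : Multiset Gen) : (Multiset.toFinsupp s).degree = s.card := by
  rw [Finsupp.degree_eq_sum]
  simp only [Multiset.toFinsupp_apply]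
  exact Multiset.sum_count_eq_card (fun a _ => Finset.mem_univ a)

lemma rescale_mon (s : Multiset Gen) :
    rescale (mon s) = (((s.card + 2) * (s.card + 1) : ℕ) : ℂ) • mon s := by
  rw [mon, rescale_monomial, degree_toFinsupp]

lemma rescale_symbol_tr (ε : ℝ) (w : W ε) :
    rescale (symbol ε (tr ε w)) = (2 : ℂ) • lap (symbol ε w) := by
  have h : rescale ∘ₗ symbol ε ∘ₗ tr ε = (2 : ℂ) • (lap ∘ₗ symbol ε) := by
    refine (symBasis ε).ext fun s => ?_
    rw [symBasis_apply]
    simp only [LinearMap.comp_apply, LinearMap.smul_apply]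
    rw [two_lap, symbol_S]
    rcases Nat.lt_or_ge s.card 2 with hs | hs
    · rw [tr_S_of_card_lt ε hs, map_zero, map_zero]
      symm
      refine Finset.sum_eq_zero fun x _ => Finset.sum_eq_zero fun y _ => ?_
      split_ifs
      · rfl
      · simp only [Derivation.map_smul, pderiv_mon]
        by_cases hx : x ∈ s
        · have : (s.erase x).count y = 0 := by
            rw [← Nat.le_zero]
            refine (Multiset.count_le_card _ _).trans ?_
            rw [Multiset.card_erase_of_mem hx]
            exact Nat.pred_le_pred (Nat.lt_succ_iff.1 hs)
          simp [this]
        · simp [Multiset.count_eq_zero_of_notMem hx]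
    · rw [tr_S_of_le_card ε hs]
      simp only [map_sum]
      have hz : ∀ x, x ∉ s → ∀ y, (if bracket x y = 0 then (0 : MvPolynomial Gen ℂ)
          else MvPolynomial.pderiv y (MvPolynomial.pderiv x ((nWords s : ℂ) • mon s))) = 0 := by
        intro x hx y
        split_ifs
        · rfl
        · simp [pderiv_mon, Multiset.count_eq_zero_of_notMem hx]
      rw [← Finset.sum_subset (Finset.subset_univ s.toFinset) fun x _ hx =>
        Finset.sum_eq_zero fun y _ => hz x (by simpa using hx) y]
      refine Finset.sum_congr rfl fun x hx => ?_
      rw [Multiset.mem_toFinset] at hx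
      have hz' : ∀ y, y ∉ s.erase x → (if bracket x y = 0 then (0 : MvPolynomial Gen ℂ)
          else MvPolynomial.pderiv y (MvPolynomial.pderiv x ((nWords s : ℂ) • mon s))) = 0 := by
        intro y hy
        split_ifs
        · rfl
        · simp only [Derivation.map_smul, pderiv_mon]
          rw [Multiset.count_eq_zero_of_notMem hy]
          simp
      rw [← Finset.sum_subset (Finset.subset_univ (s.erase x).toFinset) fun y _ hy =>
        hz' y (by simpa using hy)]
      refine Finset.sum_congr rfl fun y hy => ?_
      rw [Multiset.mem_toFinset] at hy
      split_ifs
      · simp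
      · simp only [map_smul, Derivation.map_smul, pderiv_mon, symbol_S, rescale_mon, smul_smul]
        congr 1
        have h1 := nWords_erase hx
        have h2 := nWords_erase hy
        have c1 : (s.erase x).card + 1 = s.card := by
          rw [Multiset.card_erase_of_mem hx]; exact Nat.succ_pred_eq_of_pos (by omega)
        have c2 : ((s.erase x).erase y).card + 1 = (s.erase x).card := by
          rw [Multiset.card_erase_of_mem hy]; exact Nat.succ_pred_eq_of_pos (by omega)
        have e1 : ((s.erase x).erase y).card + 2 = s.card := by omega
        rw [e1, c2]
        norm_cast
        calc nWords ((s.erase x).erase y) * (s.card * (s.erase x).card)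
            = s.card * ((s.erase x).card * nWords ((s.erase x).erase y)) := by ring
          _ = (s.erase x).count y * (s.card * nWords (s.erase x)) := by rw [h2]; ring
          _ = nWords s * s.count x * (s.erase x).count y := by rw [h1]; ring
  exact congrArg (fun f => f w) h

lemma symbol_injective (ε : ℝ) : Function.Injective (symbol ε) := by
  rw [injective_iff_map_eq_zero]
  intro w hw
  have h := linearIndependent_iff.1 (linearIndependent_symbol_S ε) ((symBasis ε).repr w)
  have h1 : w = Finsupp.linearCombination ℂ (S ε) ((symBasis ε).repr w) := by
    conv_lhs => rw [← (symBasis ε).linearCombination_repr w]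
    congr 2
    ext1 s
    exact symBasis_apply ε s
  rw [h1, Finsupp.apply_linearCombination] at hw
  have h2 := h hw
  rwa [LinearEquiv.map_eq_zero_iff] at h2

lemma symbol_surjective (ε : ℝ) : Function.Surjective (symbol ε) := by
  intro p
  induction p using MvPolynomial.induction_on' with
  | monomial n a =>
    refine ⟨(a / nWords (Finsupp.toMultiset n)) • S ε (Finsupp.toMultiset n), ?_⟩
    have hne : (nWords (Finsupp.toMultiset n) : ℂ) ≠ 0 := Nat.cast_ne_zero.2 (nWords_pos _).ne'
    rw [map_smul, symbol_S, smul_smul, div_mul_cancel₀ _ hne, mon, MvPolynomial.smul_monomial]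
    simp
  | add p q hp hq =>
    obtain ⟨u, rfl⟩ := hp
    obtain ⟨v, rfl⟩ := hq
    exact ⟨u + v, map_add _ _ _⟩

lemma mem_Psi_iff {ε : ℝ} {w : W ε} : w ∈ Psi ε ↔ lap (symbol ε w) = 0 := by
  have h := rescale_symbol_tr ε w
  rw [Psi, LinearMap.mem_ker]
  constructor
  · intro h0
    rw [h0, map_zero, map_zero] at h
    exact (smul_eq_zero.1 h.symm).resolve_left two_ne_zero
  · intro h0
    rw [h0, smul_zero] at h
    exact symbol_injective ε (by rw [rescale_eq_zero h, map_zero])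

/-! ### The Jordan-Schwinger elements -/

/-- `J_0 = (a_+ a_- - b_+ b_-) / 2`. -/
def J0 (ε : ℝ) : W ε := (1 / 2 : ℂ) • (gen ε Gen.ap * gen ε Gen.am - gen ε Gen.bp * gen ε Gen.bm)

/-- `J_+ = a_+ b_-`. -/
def Jp (ε : ℝ) : W ε := gen ε Gen.ap * gen ε Gen.bm

/-- `J_- = a_- b_+`. -/
def Jm (ε : ℝ) : W ε := gen ε Gen.am * gen ε Gen.bp

/-- `K_0 = (a_+ a_- + b_+ b_- + ε) / 2`. -/
def K0 (ε : ℝ) : W ε :=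
  (1 / 2 : ℂ) • (gen ε Gen.ap * gen ε Gen.am + gen ε Gen.bp * gen ε Gen.bm
    + algebraMap ℂ (W ε) (ε : ℂ))

/-! ### Multiplication by `K_0 - R̂` is complementary to the traceless polynomials -/

/-- The polynomial `a_+ a_- + b_+ b_-`. -/
def quadK : MvPolynomial Gen ℂ :=
  MvPolynomial.X Gen.ap * MvPolynomial.X Gen.am + MvPolynomial.X Gen.bp * MvPolynomial.X Gen.bm

/-- The product of the factorials of the exponents. -/
def factD (d : Gen →₀ ℕ) : ℕ := ∏ g, (d g).factorial

lemma factD_add (d : Gen →₀ ℕ) (x : Gen) :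
    factD (d + Finsupp.single x 1) = (d x + 1) * factD d := by
  rw [factD, factD, ← Finset.mul_prod_erase _ _ (Finset.mem_univ x),
    ← Finset.mul_prod_erase _ (fun g => (d g).factorial) (Finset.mem_univ x), ← mul_assoc]
  congr 1
  · simp [Nat.factorial_succ]
  · refine Finset.prod_congr rfl fun y hy => ?_
    simp [Finsupp.single_eq_of_ne (Finset.ne_of_mem_erase hy)]

/-- The bilinear pairing for which multiplication by a variable is adjoint to differentiation. -/
def pair (q : MvPolynomial Gen ℂ) : MvPolynomial Gen ℂ →ₗ[ℂ] ℂ :=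
  (MvPolynomial.basisMonomials Gen ℂ).constr ℂ fun d => (factD d : ℂ) * MvPolynomial.coeff d q

lemma pair_monomial (q : MvPolynomial Gen ℂ) (d : Gen →₀ ℕ) (c : ℂ) :
    pair q (MvPolynomial.monomial d c) = c * (factD d * MvPolynomial.coeff d q) := by
  have := (MvPolynomial.basisMonomials Gen ℂ).constr_basis ℂ
    (fun d => (factD d : ℂ) * MvPolynomial.coeff d q) d
  rw [MvPolynomial.coe_basisMonomials] at this
  have h : MvPolynomial.monomial d c = c • MvPolynomial.monomial d (1 : ℂ) := by
    rw [MvPolynomial.smul_monomial, smul_eq_mul, mul_one]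
  rw [h, map_smul, pair, this, smul_eq_mul]

lemma pair_X_mul (q p : MvPolynomial Gen ℂ) (x : Gen) :
    pair q (MvPolynomial.X x * p) = pair (MvPolynomial.pderiv x q) p := by
  induction p using MvPolynomial.induction_on' with
  | monomial n a =>
    rw [MvPolynomial.X, MvPolynomial.monomial_mul, one_mul, pair_monomial, pair_monomial,
      MvPolynomial.coeff_pderiv, add_comm (Finsupp.single x 1) n, factD_add]
    push_cast
    ring
  | add p q hp hq => rw [mul_add, map_add, map_add, hp, hq]

lemma pair_quadK_mul (q p : MvPolynomial Gen ℂ) : pair q (quadK * p) = pair (lap q) p := by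
  have hadd : ∀ a b : MvPolynomial Gen ℂ, pair (a + b) p = pair a p + pair b p := by
    intro a b
    induction p using MvPolynomial.induction_on' with
    | monomial n c => simp only [pair_monomial, MvPolynomial.coeff_add]; ring
    | add p q hp hq => rw [map_add, map_add, map_add, hp, hq]; ring
  rw [quadK, add_mul, map_add, mul_assoc, mul_assoc, pair_X_mul, pair_X_mul, pair_X_mul,
    pair_X_mul, lap_apply, hadd, pderiv_symm Gen.am, pderiv_symm Gen.bm]

lemma pair_conj_eq_zero {q : MvPolynomial Gen ℂ}
    (h : pair q (MvPolynomial.map (starRingEnd ℂ) q) = 0) : q = 0 := by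
  have h1 : pair q (MvPolynomial.map (starRingEnd ℂ) q)
      = ((∑ d ∈ q.support, (factD d : ℝ) * Complex.normSq (MvPolynomial.coeff d q) : ℝ) : ℂ) := by
    conv_lhs => rw [MvPolynomial.as_sum q]
    rw [map_sum, map_sum]
    rw [← MvPolynomial.as_sum q]
    push_cast
    refine Finset.sum_congr rfl fun d _ => ?_
    rw [MvPolynomial.map_monomial, pair_monomial, Complex.normSq_eq_conj_mul_self]
    ring
  rw [h1] at h
  have h2 := Complex.ofReal_eq_zero.1 h
  rw [Finset.sum_eq_zero_iff_of_nonneg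
    (fun d _ => mul_nonneg (Nat.cast_nonneg _) (Complex.normSq_nonneg _))] at h2
  ext d
  rw [MvPolynomial.coeff_zero]
  by_contra hd
  have h3 := h2 d (MvPolynomial.mem_support_iff.2 hd)
  have h4 : (factD d : ℝ) ≠ 0 :=
    Nat.cast_ne_zero.2 (Finset.prod_ne_zero_iff.2 fun g _ => Nat.factorial_ne_zero _)
  exact hd (Complex.normSq_eq_zero.1 ((mul_eq_zero.1 h3).resolve_left h4))

lemma quadK_ne_zero : quadK ≠ 0 := by
  intro h
  have := congrArg (MvPolynomial.eval fun g => if g = Gen.ap ∨ g = Gen.am then (1 : ℂ) else 0) h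
  simp [quadK] at this

lemma lap_quadK_mul_eq_zero {p : MvPolynomial Gen ℂ} (h : lap (quadK * p) = 0) : p = 0 := by
  have h1 : pair (quadK * p) (MvPolynomial.map (starRingEnd ℂ) (quadK * p)) = 0 := by
    have hk : MvPolynomial.map (starRingEnd ℂ) quadK = quadK := by simp [quadK]
    rw [map_mul, hk, pair_quadK_mul, h]
    induction MvPolynomial.map (starRingEnd ℂ) p using MvPolynomial.induction_on' with
    | monomial n c => simp [pair_monomial]
    | add p q hp hq => rw [map_add, hp, hq, add_zero]
  exact (mul_eq_zero.1 (pair_conj_eq_zero h1)).resolve_left quadK_ne_zero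

/-- All monomials in `p` have degree less than `N`. -/
def DegLT (N : ℕ) (p : MvPolynomial Gen ℂ) : Prop :=
  ∀ d : Gen →₀ ℕ, N ≤ d.degree → MvPolynomial.coeff d p = 0

lemma DegLT.mono {N M : ℕ} {p : MvPolynomial Gen ℂ} (h : DegLT N p) (hNM : N ≤ M) :
    DegLT M p := fun d hd => h d (hNM.trans hd)

lemma DegLT.add {N : ℕ} {p q : MvPolynomial Gen ℂ} (hp : DegLT N p) (hq : DegLT N q) :
    DegLT N (p + q) := fun d hd => by rw [MvPolynomial.coeff_add, hp d hd, hq d hd, add_zero]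

lemma DegLT.smul {N : ℕ} {p : MvPolynomial Gen ℂ} (c : ℂ) (hp : DegLT N p) :
    DegLT N (c • p) := fun d hd => by rw [MvPolynomial.coeff_smul, hp d hd, smul_zero]

lemma DegLT.pderiv {N : ℕ} {p : MvPolynomial Gen ℂ} (x : Gen) (hp : DegLT (N + 1) p) :
    DegLT N (MvPolynomial.pderiv x p) := fun d hd => by
  rw [MvPolynomial.coeff_pderiv, hp _ (by simpa using hd), zero_mul]

lemma DegLT.symD {N : ℕ} {p : MvPolynomial Gen ℂ} (x : Gen) (hp : DegLT (N + 1) p) :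
    DegLT N (symD x p) := by
  rw [symD_apply, sum_gen]
  exact ((hp.pderiv _).smul _).add (((hp.pderiv _).smul _).add
    (((hp.pderiv _).smul _).add ((hp.pderiv _).smul _)))

lemma DegLT.X_mul {N : ℕ} {p : MvPolynomial Gen ℂ} (x : Gen) (hp : DegLT N p) :
    DegLT (N + 1) (MvPolynomial.X x * p) := fun d hd => by
  rw [MvPolynomial.coeff_X_mul']
  split_ifs with h
  · refine hp _ ?_
    have h1 : d - Finsupp.single x 1 + Finsupp.single x 1 = d :=
      Finsupp.sub_add_single_one_cancel (Finsupp.mem_support_iff.1 h)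
    have h2 := congrArg Finsupp.degree h1
    rw [map_add, Finsupp.degree_single] at h2
    omega
  · rfl

lemma DegLT.lap {N : ℕ} {p : MvPolynomial Gen ℂ} (hp : DegLT (N + 2) p) : DegLT N (lap p) := by
  rw [lap_apply]
  exact ((hp.pderiv _).pderiv _).add ((hp.pderiv _).pderiv _)

lemma DegLT.quadK_mul {N : ℕ} {p : MvPolynomial Gen ℂ} (hp : DegLT N p) :
    DegLT (N + 2) (quadK * p) := by
  rw [quadK, add_mul, mul_assoc, mul_assoc]
  exact ((hp.X_mul _).X_mul _).add ((hp.X_mul _).X_mul _)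

lemma opM_opM (c : ℂ) (x y : Gen) (p : MvPolynomial Gen ℂ) :
    opM c x (opM c y p) = MvPolynomial.X x * (MvPolynomial.X y * p)
      + (c • (MvPolynomial.X x * symD y p) + c • symD x (MvPolynomial.X y * p)
        + c • c • symD x (symD y p)) := by
  simp only [opM_apply, map_add, Derivation.map_smul, mul_smul_comm]
  abel

lemma DegLT.lower {N : ℕ} {p : MvPolynomial Gen ℂ} (c : ℂ) (x y : Gen) (hp : DegLT (N + 1) p) :
    DegLT (N + 1) (c • (MvPolynomial.X x * FuzzySphere.symD y p)
      + c • FuzzySphere.symD x (MvPolynomial.X y * p)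
        + c • c • FuzzySphere.symD x (FuzzySphere.symD y p)) := by
  refine ((((hp.symD y).X_mul x).smul c).add (((hp.X_mul y).symD x).smul c)).add ?_
  have h : DegLT (N + 1) (FuzzySphere.symD y p) := (hp.symD y).mono (Nat.le_succ N)
  exact (((h.symD x).mono (Nat.le_succ N)).smul c).smul c

/-- `R̂ = (R² + ε² / 4) ^ (1/2)`. -/
def Rhat (ε R : ℝ) : ℝ := Real.sqrt (R ^ 2 + ε ^ 2 / 4)

/-- The kernel `{w (K_0 - R̂) | w ∈ W}` of the projection `ρ`. -/
def kerRho (ε R : ℝ) : Submodule ℂ (W ε) :=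
  LinearMap.range (LinearMap.mulRight ℂ (K0 ε - algebraMap ℂ (W ε) (Rhat ε R : ℂ)))

/-- The operator on symbols given by right multiplication with `K_0 - R̂` followed by `lap`. -/
def lapK (ε R : ℝ) : MvPolynomial Gen ℂ →ₗ[ℂ] MvPolynomial Gen ℂ :=
  lap ∘ₗ ((1 / 2 : ℂ) • (opM (-(ε / 2)) Gen.am * opM (-(ε / 2)) Gen.ap
    + opM (-(ε / 2)) Gen.bm * opM (-(ε / 2)) Gen.bp) + ((ε : ℂ) / 2 - Rhat ε R) • 1)

lemma lap_symbol_mul (ε R : ℝ) (w : W ε) :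
    lap (symbol ε (w * (K0 ε - algebraMap ℂ (W ε) (Rhat ε R : ℂ)))) = lapK ε R (symbol ε w) := by
  have h : symbol ε (w * (K0 ε - algebraMap ℂ (W ε) (Rhat ε R : ℂ)))
      = (1 / 2 : ℂ) • (opM (-(ε / 2)) Gen.am (opM (-(ε / 2)) Gen.ap (symbol ε w))
        + opM (-(ε / 2)) Gen.bm (opM (-(ε / 2)) Gen.bp (symbol ε w)))
        + ((ε : ℂ) / 2 - Rhat ε R) • symbol ε w := by
    rw [← symbol_mul_gen, ← symbol_mul_gen, ← symbol_mul_gen, ← symbol_mul_gen, ← map_add,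
      ← map_smul, ← map_smul, ← map_add]
    congr 1
    rw [K0, Algebra.algebraMap_eq_smul_one, Algebra.algebraMap_eq_smul_one]
    simp only [mul_sub, mul_add, mul_smul_comm, mul_one, mul_assoc]
    module
  rw [h]
  rfl

lemma lapK_apply (ε R : ℝ) (p : MvPolynomial Gen ℂ) : ∃ E : MvPolynomial Gen ℂ,
    lapK ε R p = (1 / 2 : ℂ) • lap (quadK * p) + lap E ∧ ∀ N, DegLT (N + 1) p → DegLT (N + 1) E := by
  refine ⟨(1 / 2 : ℂ) • (_ + _) + ((ε : ℂ) / 2 - Rhat ε R) • p, ?_, fun N hp =>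
    (((hp.lower (-(ε / 2)) Gen.am Gen.ap).add (hp.lower (-(ε / 2)) Gen.bm Gen.bp)).smul _).add
      (hp.smul _)⟩
  simp only [lapK, LinearMap.comp_apply, LinearMap.add_apply, LinearMap.smul_apply,
    Module.End.mul_apply, Module.End.one_apply]
  rw [← map_smul, ← map_add, opM_opM, opM_opM]
  congr 1
  have hk : quadK * p = MvPolynomial.X Gen.am * (MvPolynomial.X Gen.ap * p)
      + MvPolynomial.X Gen.bm * (MvPolynomial.X Gen.bp * p) := by
    rw [quadK]; ring
  rw [hk]
  simp only [smul_add]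
  abel

lemma lapK_eq_zero {ε R : ℝ} {p : MvPolynomial Gen ℂ} (h : lapK ε R p = 0) : p = 0 := by
  by_contra hp
  obtain ⟨E, hE, hdeg⟩ := lapK_apply ε R p
  set N := p.totalDegree with hN
  have hpN : DegLT (N + 1) p := fun d hd => by
    by_contra hc
    have h1 := MvPolynomial.le_totalDegree (MvPolynomial.mem_support_iff.2 hc)
    have h2 : (d.sum fun _ e => e) = d.degree := rfl
    omega
  set q := MvPolynomial.homogeneousComponent N p with hq
  have hqp : DegLT N (p - q) := fun d hd => by
    rw [MvPolynomial.coeff_sub, hq, MvPolynomial.coeff_homogeneousComponent]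
    split_ifs with hdN
    · exact sub_self _
    · rw [hpN d (by omega), sub_zero]
  have hqh : (lap (quadK * q)).IsHomogeneous N := by
    have hk : quadK.IsHomogeneous 2 :=
      ((MvPolynomial.isHomogeneous_X ℂ _).mul (MvPolynomial.isHomogeneous_X ℂ _)).add
        ((MvPolynomial.isHomogeneous_X ℂ _).mul (MvPolynomial.isHomogeneous_X ℂ _))
    have h2 := hk.mul (MvPolynomial.homogeneousComponent_isHomogeneous N p)
    have h3 : 2 + N - 1 - 1 = N := by omega
    rw [lap_apply]
    have ha := (h2.pderiv (i := Gen.am)).pderiv (i := Gen.ap)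
    have hb := (h2.pderiv (i := Gen.bm)).pderiv (i := Gen.bp)
    rw [h3] at ha hb
    exact ha.add hb
  have hlt : DegLT N (lap (quadK * q)) := by
    have e : lap (quadK * q) = (-1 : ℂ) • lap (quadK * (p - q)) + (-2 : ℂ) • lap E := by
      rw [h] at hE
      have h1 : lap (quadK * p) = (-2 : ℂ) • lap E := by
        have := congrArg (fun z => (2 : ℂ) • z) hE
        simp only [smul_zero, smul_add, smul_smul] at this
        norm_num at this
        rw [neg_smul]
        exact eq_neg_of_add_eq_zero_left this.symm
      rw [mul_sub, map_sub, h1, neg_one_smul]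
      abel
    rw [e]
    refine (hqp.quadK_mul.lap.smul _).add (DegLT.smul _ ?_)
    exact ((hdeg N hpN).mono (Nat.le_succ _)).lap
  have h0 : lap (quadK * q) = 0 := by
    ext d
    rw [MvPolynomial.coeff_zero]
    by_cases hd : d.degree = N
    · exact hlt d hd.ge
    · exact hqh.coeff_eq_zero hd
  have hq0 := lap_quadK_mul_eq_zero h0
  rw [hq0, sub_zero] at hqp
  have hne := MvPolynomial.support_nonempty.2 hp
  obtain ⟨d, hd, hd'⟩ := Finset.exists_mem_eq_sup p.support hne fun s => s.sum fun _ e => e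
  refine MvPolynomial.mem_support_iff.1 hd (hqp d ?_)
  exact (le_of_eq hd')

lemma lapK_surjective (ε R : ℝ) : Function.Surjective (lapK ε R) := by
  intro p
  have hiff : ∀ (N : ℕ) (q : MvPolynomial Gen ℂ),
      q ∈ MvPolynomial.restrictTotalDegree Gen ℂ N ↔ DegLT (N + 1) q := by
    intro N q
    rw [MvPolynomial.mem_restrictTotalDegree]
    constructor
    · intro h d hd
      by_contra hc
      have h1 := MvPolynomial.le_totalDegree (MvPolynomial.mem_support_iff.2 hc)
      have h2 : (d.sum fun _ e => e) = d.degree := rfl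
      omega
    · intro h
      refine Finset.sup_le fun d hd => ?_
      by_contra hc
      have h2 : (d.sum fun _ e => e) = d.degree := rfl
      exact MvPolynomial.mem_support_iff.1 hd (h d (by omega))
  set N := p.totalDegree
  have hmaps : ∀ q ∈ MvPolynomial.restrictTotalDegree Gen ℂ N,
      lapK ε R q ∈ MvPolynomial.restrictTotalDegree Gen ℂ N := by
    intro q hq
    rw [hiff] at hq ⊢
    obtain ⟨E, hE, hdeg⟩ := lapK_apply ε R q
    rw [hE]
    exact (hq.quadK_mul.lap.smul _).add
      (((hdeg N hq).mono (by omega : N + 1 ≤ N + 1 + 2)).lap)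
  have hinj : Function.Injective ((lapK ε R).restrict hmaps) := by
    rw [injective_iff_map_eq_zero]
    intro q hq
    exact Subtype.ext (lapK_eq_zero (congrArg Subtype.val hq))
  have hsurj := LinearMap.surjective_of_injective hinj
  obtain ⟨q, hq⟩ := hsurj ⟨p, (MvPolynomial.mem_restrictTotalDegree _ _ _).2 le_rfl⟩
  exact ⟨q, congrArg Subtype.val hq⟩

lemma isCompl_Psi_kerRho (ε R : ℝ) : IsCompl (Psi ε) (kerRho ε R) := by
  constructor
  · rw [Submodule.disjoint_def]
    rintro _ hw ⟨u, rfl⟩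
    rw [mem_Psi_iff, LinearMap.mulRight_apply, lap_symbol_mul] at hw
    have : u = 0 := symbol_injective ε (by rw [lapK_eq_zero hw, map_zero])
    rw [this, map_zero]
  · rw [codisjoint_iff, eq_top_iff]
    intro w _
    obtain ⟨p, hp⟩ := lapK_surjective ε R (lap (symbol ε w))
    obtain ⟨u, rfl⟩ := symbol_surjective ε p
    rw [← lap_symbol_mul] at hp
    rw [Submodule.mem_sup]
    refine ⟨w - u * (K0 ε - algebraMap ℂ (W ε) (Rhat ε R : ℂ)), ?_, _, ⟨u, rfl⟩, ?_⟩
    · rw [mem_Psi_iff, map_sub, map_sub, hp, sub_self]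
    · simp

/-- The projection `ρ_R` of `W(ε)` onto `Ψ` with kernel `{w (K_0 - R̂) | w ∈ W}`. -/
def rho (ε R : ℝ) : W ε →ₗ[ℂ] W ε :=
  (Psi ε).projection (kerRho ε R) (isCompl_Psi_kerRho ε R)

/-! ### Conjugation and the sesquilinear form -/

/-- The conjugate of a generator. -/
def conjGen : Gen → Gen
  | Gen.ap => Gen.am
  | Gen.am => Gen.ap
  | Gen.bp => Gen.bm
  | Gen.bm => Gen.bp

/-- A ring morphism which is conjugate-linear, into the opposite ring: it is obtained from the
universal property of `W(ε)`, the opposite ring being an algebra through complex conjugation. -/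
def daggerHom (ε : ℝ) : W ε →+* (W ε)ᵐᵒᵖ :=
  letI : Algebra ℂ (W ε)ᵐᵒᵖ :=
    ((algebraMap ℂ (W ε)ᵐᵒᵖ).comp (starRingEnd ℂ)).toAlgebra' fun c x =>
      Algebra.commutes (starRingEnd ℂ c) x
  (liftW ε (fun g => MulOpposite.op (gen ε (conjGen g))) (fun x y => by
    have h := gen_comm ε (conjGen y) (conjGen x)
    have hb : bracket (conjGen y) (conjGen x) = starRingEnd ℂ (bracket x y) := by
      cases x <;> cases y <;> simp [bracket, conjGen]
    rw [← MulOpposite.op_mul, ← MulOpposite.op_mul, ← MulOpposite.op_sub, h, hb]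
    change _ = MulOpposite.op (algebraMap ℂ (W ε) (starRingEnd ℂ ((ε : ℂ) * bracket x y)))
    rw [map_mul (starRingEnd ℂ), Complex.conj_ofReal])).toRingHom

/-- The conjugation `†` on `W(ε)`. -/
def dagger (ε : ℝ) (w : W ε) : W ε := MulOpposite.unop (daggerHom ε w)

lemma dagger_gen (ε : ℝ) (g : Gen) : dagger ε (gen ε g) = gen ε (conjGen g) := by
  let : Algebra ℂ (W ε)ᵐᵒᵖ :=
    ((algebraMap ℂ (W ε)ᵐᵒᵖ).comp (starRingEnd ℂ)).toAlgebra' fun c x =>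
      Algebra.commutes (starRingEnd ℂ c) x
  have h : daggerHom ε (gen ε g) = MulOpposite.op (gen ε (conjGen g)) := liftW_gen _ _ _ _
  rw [dagger, h, MulOpposite.unop_op]

lemma dagger_algebraMap (ε : ℝ) (c : ℂ) :
    dagger ε (algebraMap ℂ (W ε) c) = algebraMap ℂ (W ε) (starRingEnd ℂ c) := by
  let inst : Algebra ℂ (W ε)ᵐᵒᵖ :=
    ((algebraMap ℂ (W ε)ᵐᵒᵖ).comp (starRingEnd ℂ)).toAlgebra' fun c x =>
      Algebra.commutes (starRingEnd ℂ c) x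
  have h : daggerHom ε (algebraMap ℂ (W ε) c) = @algebraMap ℂ (W ε)ᵐᵒᵖ _ _ inst c :=
    AlgHom.commutes _ c
  rw [dagger, h]
  rfl

lemma dagger_mul (ε : ℝ) (v w : W ε) : dagger ε (v * w) = dagger ε w * dagger ε v := by
  simp [dagger]

lemma dagger_add (ε : ℝ) (v w : W ε) : dagger ε (v + w) = dagger ε v + dagger ε w := by
  simp [dagger]

lemma dagger_smul (ε : ℝ) (c : ℂ) (w : W ε) :
    dagger ε (c • w) = starRingEnd ℂ c • dagger ε w := by
  rw [Algebra.smul_def, dagger_mul, dagger_algebraMap, Algebra.smul_def, Algebra.commutes]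

/-- The component `π_0` of degree zero: the coefficient of `1 = S(0)` in the expansion in the
symmetric polynomials. -/
def pi0 (ε : ℝ) (w : W ε) : ℂ := (symBasis ε).repr w 0

/-- The sesquilinear form `⟨ξ, ζ⟩ = π_0(ρ_R(ξ† ζ))`. -/
def innerProd (ε R : ℝ) (ξ ζ : W ε) : ℂ := pi0 ε (rho ε R (dagger ε ξ * ζ))

/-- The quadratic map `‖ζ‖² = ⟨ζ, ζ⟩`, as a real number. -/
def normSqR (ε R : ℝ) (ζ : W ε) : ℝ := (innerProd ε R ζ ζ).re

/-! ### The adjoint action, its limit at `ε = 0`, and the elements `P(n, r, m)` -/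

/-- The adjoint `Ad T (w) = [T, w]`. -/
def Ad (ε : ℝ) (T : W ε) : Module.End ℂ (W ε) :=
  LinearMap.mulLeft ℂ T - LinearMap.mulRight ℂ T

lemma Ad_apply (ε : ℝ) (T w : W ε) : Ad ε T w = T * w - w * T := rfl

/-- The translation `w(x) ↦ w(x + η)` of the variable `x` by an infinitesimal `η` with
`η ^ 2 = 0`. -/
def shift (ε : ℝ) (x : Gen) : W ε →ₐ[ℂ] TrivSqZeroExt (W ε) (W ε) :=
  liftW ε (fun g => TrivSqZeroExt.inl (gen ε g) + TrivSqZeroExt.inr (if g = x then 1 else 0))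
    (fun g h => by
      have e := gen_comm ε g h
      refine TrivSqZeroExt.ext ?_ ?_
      · rw [TrivSqZeroExt.algebraMap_eq_inl', TrivSqZeroExt.fst_inl, ← e]
        simp only [TrivSqZeroExt.fst_sub, TrivSqZeroExt.fst_mul, TrivSqZeroExt.fst_add,
          TrivSqZeroExt.fst_inl, TrivSqZeroExt.fst_inr, add_zero]
      · rw [TrivSqZeroExt.algebraMap_eq_inl', TrivSqZeroExt.snd_inl]
        by_cases hg : g = x <;> by_cases hh : h = x <;> simp [hg, hh])

/-- The partial derivative `∂w/∂x`, the coefficient of `η` in `w(x + η)`. -/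
def pd (ε : ℝ) (x : Gen) : W ε →ₗ[ℂ] W ε :=
  (TrivSqZeroExt.sndHom (W ε) (W ε)).restrictScalars ℂ ∘ₗ (shift ε x).toLinearMap

lemma shift_gen (ε : ℝ) (x g : Gen) : shift ε x (gen ε g)
    = TrivSqZeroExt.inl (gen ε g) + TrivSqZeroExt.inr (if g = x then 1 else 0) :=
  liftW_gen _ _ _ _

lemma pd_gen (ε : ℝ) (x g : Gen) : pd ε x (gen ε g) = if g = x then 1 else 0 := by
  have h : pd ε x (gen ε g) = (shift ε x (gen ε g)).snd := rfl
  rw [h, shift_gen, TrivSqZeroExt.snd_add, TrivSqZeroExt.snd_inl, TrivSqZeroExt.snd_inr, zero_add]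

lemma fst_shift (ε : ℝ) (x : Gen) (w : W ε) : (shift ε x w).fst = w := by
  obtain ⟨u, rfl⟩ := toW_surjective ε w
  induction u using FreeAlgebra.induction with
  | grade0 r => rw [AlgHom.commutes, AlgHom.commutes]; rfl
  | grade1 g =>
    change (shift ε x (gen ε g)).fst = gen ε g
    rw [shift_gen, TrivSqZeroExt.fst_add, TrivSqZeroExt.fst_inl, TrivSqZeroExt.fst_inr, add_zero]
  | mul a b ha hb => rw [map_mul, map_mul, TrivSqZeroExt.fst_mul, ha, hb]
  | add a b ha hb => rw [map_add, map_add, TrivSqZeroExt.fst_add, ha, hb]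

lemma pd_mul (ε : ℝ) (x : Gen) (v w : W ε) :
    pd ε x (v * w) = v * pd ε x w + pd ε x v * w := by
  have h : ∀ w, pd ε x w = (shift ε x w).snd := fun _ => rfl
  rw [h, h, h, map_mul, TrivSqZeroExt.snd_mul, fst_shift, fst_shift]
  simp

/-- The limit of `(1/ε) Ad T (w)` for `ε → 0`: the Poisson bracket
`∑ (∂T/∂χ_- ∂w/∂χ_+ - ∂T/∂χ_+ ∂w/∂χ_-)`, summed over `χ = a, b`. -/
def poisson (ε : ℝ) (T : W ε) : W ε →ₗ[ℂ] W ε :=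
  LinearMap.mulLeft ℂ (pd ε Gen.am T) ∘ₗ pd ε Gen.ap
    - LinearMap.mulLeft ℂ (pd ε Gen.ap T) ∘ₗ pd ε Gen.am
    + LinearMap.mulLeft ℂ (pd ε Gen.bm T) ∘ₗ pd ε Gen.bp
    - LinearMap.mulLeft ℂ (pd ε Gen.bp T) ∘ₗ pd ε Gen.bm

/-- The operator `(1/ε) Ad T`, which for `ε = 0` means its limit. -/
def scaledAd (ε : ℝ) (T : W ε) : Module.End ℂ (W ε) :=
  if ε = 0 then poisson ε T else (ε : ℂ)⁻¹ • Ad ε T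

/-- The operator `Δ`. -/
def casimir (ε : ℝ) : Module.End ℂ (W ε) :=
  Ad ε (J0 ε) * Ad ε (J0 ε) + (1 / 2 : ℂ) • (Ad ε (Jp ε) * Ad ε (Jm ε))
    + (1 / 2 : ℂ) • (Ad ε (Jm ε) * Ad ε (Jp ε))

/-- The operator `(1/ε²) Δ`, which for `ε = 0` means its limit. -/
def scaledCasimir (ε : ℝ) : Module.End ℂ (W ε) :=
  scaledAd ε (J0 ε) * scaledAd ε (J0 ε)
    + (1 / 2 : ℂ) • (scaledAd ε (Jp ε) * scaledAd ε (Jm ε))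
    + (1 / 2 : ℂ) • (scaledAd ε (Jm ε) * scaledAd ε (Jp ε))

/-- The space `Ψ^n` of traceless homogeneous polynomials of degree `2n`. -/
def PsiDeg (ε n : ℝ) : Submodule ℂ (W ε) := Psi ε ⊓ Wn ε n

/-- The space `Ψ_r` of all `ξ ∈ Ψ` with `(1/ε) Ad K_0 ξ = r ξ`. -/
def PsiK (ε r : ℝ) : Submodule ℂ (W ε) :=
  Psi ε ⊓ LinearMap.ker (scaledAd ε (K0 ε) - (r : ℂ) • 1)

/-- The space `Ψ^m` of all `ξ ∈ Ψ` with `(1/ε) Ad J_0 ξ = m ξ`. -/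
def PsiJ (ε m : ℝ) : Submodule ℂ (W ε) :=
  Psi ε ⊓ LinearMap.ker (scaledAd ε (J0 ε) - (m : ℂ) • 1)

/-- The conditions `2n, n + r, n + m ∈ ℤ`, `|r| ≤ n`, `|m| ≤ n` on the labels. -/
def Admissible (n r m : ℝ) : Prop :=
  (∃ k : ℤ, 2 * n = k) ∧ (∃ k : ℤ, n + r = k) ∧ (∃ k : ℤ, n + m = k) ∧ |r| ≤ n ∧ |m| ≤ n

/-- The set of all admissible labels `(n, r, m)`. -/
abbrev Label : Type := {i : ℝ × ℝ × ℝ // Admissible i.1 i.2.1 i.2.2}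

/-- The element
`P(n, r, m) = ε^(m-n) ((n+m)! / ((2n)! (n-m)!))^(1/2) (Ad J_-)^(n-m) (a_+^(n+r) b_-^(n-r))`,
where `ε^(m-n) (Ad J_-)^(n-m)` is written as `((1/ε) Ad J_-)^(n-m)` to cover the case `ε = 0`.
For admissible labels the numbers `2n`, `n ± r`, `n ± m` are natural numbers, and the floors
below only change their type. -/
def P (ε n r m : ℝ) : W ε :=
  (Real.sqrt ((⌊n + m⌋₊.factorial : ℝ) / (⌊2 * n⌋₊.factorial * ⌊n - m⌋₊.factorial)) : ℂ) •
    (scaledAd ε (Jm ε) ^ ⌊n - m⌋₊) (gen ε Gen.ap ^ ⌊n + r⌋₊ * gen ε Gen.bm ^ ⌊n - r⌋₊)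

lemma P_of_ne_zero {ε : ℝ} (hε : ε ≠ 0) (n r m : ℝ) :
    P ε n r m = (((ε : ℂ) ^ ⌊n - m⌋₊)⁻¹ *
      (Real.sqrt ((⌊n + m⌋₊.factorial : ℝ) / (⌊2 * n⌋₊.factorial * ⌊n - m⌋₊.factorial)) : ℂ)) •
      (Ad ε (Jm ε) ^ ⌊n - m⌋₊) (gen ε Gen.ap ^ ⌊n + r⌋₊ * gen ε Gen.bm ^ ⌊n - r⌋₊) := by
  rw [P, scaledAd, if_neg hε, smul_pow, LinearMap.smul_apply, smul_smul, inv_pow, mul_comm]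

end FuzzySphere

end

open FuzzySphere

/-!
The Weyl symbol identifies `W(ε)` with the commutative polynomials in the four generators, taking
`S(s)` to a multiple of a monomial which does not depend on `ε`, and `Ψ` to the polynomials
annihilated by the Laplacian `∂_{a_+} ∂_{a_-} + ∂_{b_+} ∂_{b_-}`. For a product `T` of two
generators, `(1/ε) Ad T` becomes a first-order derivation, the Poisson bracket with the symbol of
`T`, for every `ε` including `0` (`symbol_scaledAd_gen_mul_gen`). Hence the symbol of `P(n, r, m)`
does not depend on `ε`, and all statements except those on the sesquilinear form are statements on
polynomials, on which the derivations of `J_0`, `J_±` form an `sl₂` commuting with the Laplacian.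

The monomials are eigenvectors of the degree, of `K_0` and of `J_0`, and their eigenvalues
`(n, r, m)` are exactly the admissible labels (`admissible_weight`). Those with a common label form
a chain along which `a_+ a_-` is exchanged for `b_+ b_-`, and the Laplace equation determines each
coefficient of the chain from its neighbour (`coeff_eq_zero_of_weight_eq`). So a joint eigenspace
has dimension at most one. The vector `a_+^i b_-^j` is harmonic and of highest weight, and the usual
`sl₂` computation (`dJp_ladder_succ`) shows that its first `i + j` images under `J_-` are nonzero,
which gives the ladder equations, the joint eigenspaces and the bases (`exists_basis_P`).

The derivations of `J_0`, `J_±`, `K_0` preserve both the range and the kernel of `ρ_R`, and produce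
no constant terms, so that `π_0 ∘ ρ_R` is invariant under them (`omega_scaledAd`). Therefore
`(1/ε) Ad T` and `(1/ε) Ad T†` are adjoint. Orthogonality follows from the eigenvalues of `J_0`,
`K_0` and the Casimir operator, and the norm is constant along a multiplet because `J_+` and `J_-`
are adjoint. Explicitly `1` has squared norm `1`, `a_+` has `R̂ + ε/2`, and `a_+²` has
`(4/3) (R̂ + ε) (R̂ + ε/2)`, so that all signs occur.
-/

noncomputable section

namespace FuzzySphere

open MvPolynomial

/-! ### The quadratic elements act on symbols by derivations -/

/-- The Hamiltonian derivation `X_x {x, ·} + X_y {y, ·}` of the monomial `X_x X_y`. -/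
def sym2 (x y : Gen) : Derivation ℂ (MvPolynomial Gen ℂ) (MvPolynomial Gen ℂ) :=
  (X x : MvPolynomial Gen ℂ) • symD y + (X y : MvPolynomial Gen ℂ) • symD x

lemma sym2_apply (x y : Gen) (p : MvPolynomial Gen ℂ) :
    sym2 x y p = X x * symD y p + X y * symD x p := rfl

lemma symbol_gen (ε : ℝ) (g : Gen) : symbol ε (gen ε g) = X g := by
  rw [symbol_apply, rep_gen, opM_apply, mul_one, Derivation.map_one_eq_zero, smul_zero, add_zero]

lemma symbol_one (ε : ℝ) : symbol ε 1 = 1 := by simp [symbol_apply]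

lemma symbol_Ad (ε : ℝ) (x y : Gen) (w : W ε) :
    symbol ε (Ad ε (gen ε x * gen ε y) w) = (ε : ℂ) • sym2 x y (symbol ε w) := by
  have hb : algebraMap ℂ (MvPolynomial Gen ℂ) (bracket y x)
      = -algebraMap ℂ (MvPolynomial Gen ℂ) (bracket x y) := by
    rw [← map_neg, bracket_antisymm y x]
  have h2 : algebraMap ℂ (MvPolynomial Gen ℂ) (ε : ℂ)
      = 2 * algebraMap ℂ (MvPolynomial Gen ℂ) (ε / 2 : ℂ) := by
    rw [← map_ofNat (algebraMap ℂ (MvPolynomial Gen ℂ)) 2, ← map_mul]; congr 1; ring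
  rw [Ad_apply, map_sub, mul_assoc, symbol_gen_mul, symbol_gen_mul, ← mul_assoc, symbol_mul_gen,
    symbol_mul_gen]
  simp only [opM_apply, sym2_apply, map_add, Derivation.map_smul, Derivation.leibniz, symD_X,
    smul_eq_mul, symD_comm y x]
  rw [hb]
  simp only [Algebra.smul_def, map_neg]
  rw [h2]
  ring

lemma symbol_pd (ε : ℝ) (x : Gen) (w : W ε) :
    symbol ε (pd ε x w) = pderiv x (symbol ε w) := by
  have h : ∀ u : FreeAlgebra ℂ Gen, ∀ v : W ε,
      symbol ε (pd ε x v) = pderiv x (symbol ε v) →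
      symbol ε (pd ε x (toW ε u * v)) = pderiv x (symbol ε (toW ε u * v)) := by
    intro u
    induction u using FreeAlgebra.induction with
    | grade0 r =>
      intro v hv
      simp only [AlgHom.commutes, ← Algebra.smul_def, map_smul, Derivation.map_smul, hv]
    | grade1 g =>
      intro v hv
      change symbol ε (pd ε x (gen ε g * v)) = pderiv x (symbol ε (gen ε g * v))
      have hc : pderiv x (symD g (symbol ε v)) = symD g (pderiv x (symbol ε v)) := by
        simp only [symD_apply, map_sum, Derivation.map_smul]
        exact Finset.sum_congr rfl fun y _ => by rw [pderiv_symm]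
      rw [pd_mul, pd_gen, map_add, symbol_gen_mul, symbol_gen_mul, hv, opM_apply, opM_apply,
        map_add, Derivation.map_smul, Derivation.leibniz, hc, pderiv_X]
      by_cases hg : g = x
      · subst hg; simp; ring
      · simp [hg]
    | mul a b ha hb => intro v hv; rw [map_mul (toW ε), mul_assoc]; exact ha _ (hb v hv)
    | add a b ha hb => intro v hv; simp only [map_add, add_mul, ha v hv, hb v hv]
  obtain ⟨u, rfl⟩ := toW_surjective ε w
  have h1 : pd ε x 1 = 0 := by
    have := pd_mul ε x 1 1
    simpa using this
  simpa using h u 1 (by rw [h1, symbol_one, map_zero, Derivation.map_one_eq_zero])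

lemma W_zero_comm (v w : W 0) : v * w = w * v := by
  obtain ⟨u, rfl⟩ := toW_surjective 0 v
  induction u using FreeAlgebra.induction generalizing w with
  | grade0 r => rw [AlgHom.commutes, Algebra.commutes]
  | grade1 g =>
    apply symbol_injective
    change symbol 0 (gen 0 g * w) = symbol 0 (w * gen 0 g)
    rw [symbol_gen_mul, symbol_mul_gen]
    simp [opM_apply]
  | mul a b ha hb => rw [map_mul, mul_assoc, hb, ← mul_assoc, ha, mul_assoc]
  | add a b ha hb => rw [map_add, add_mul, mul_add, ha, hb]

/-- `(1/ε) Ad T` is linear in `T`. -/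
def scaledAdₗ (ε : ℝ) : W ε →ₗ[ℂ] Module.End ℂ (W ε) where
  toFun := scaledAd ε
  map_add' S T := by
    refine LinearMap.ext fun w => ?_
    rw [LinearMap.add_apply, scaledAd, scaledAd, scaledAd]
    split_ifs
    · simp only [poisson, LinearMap.add_apply, LinearMap.sub_apply, LinearMap.comp_apply,
        LinearMap.mulLeft_apply, map_add, add_mul]
      abel
    · simp only [LinearMap.smul_apply, Ad_apply, add_mul, mul_add, ← smul_add]
      congr 1
      abel
  map_smul' c T := by
    refine LinearMap.ext fun w => ?_
    rw [RingHom.id_apply, LinearMap.smul_apply, scaledAd, scaledAd]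
    split_ifs
    · simp only [poisson, LinearMap.add_apply, LinearMap.sub_apply, LinearMap.comp_apply,
        LinearMap.mulLeft_apply, map_smul, smul_mul_assoc, smul_sub, smul_add]
    · rw [LinearMap.smul_apply, LinearMap.smul_apply, Ad_apply, Ad_apply, smul_mul_assoc,
        mul_smul_comm, ← smul_sub, smul_comm]

lemma scaledAdₗ_apply (ε : ℝ) (T : W ε) : scaledAdₗ ε T = scaledAd ε T := rfl

lemma scaledAd_algebraMap (ε : ℝ) (c : ℂ) : scaledAd ε (algebraMap ℂ (W ε) c) = 0 := by
  refine LinearMap.ext fun w => symbol_injective ε ?_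
  rw [scaledAd]
  split_ifs
  · simp only [poisson, LinearMap.add_apply, LinearMap.sub_apply, LinearMap.comp_apply,
      LinearMap.mulLeft_apply, LinearMap.zero_apply]
    have h : ∀ x, pd ε x (algebraMap ℂ (W ε) c) = 0 := fun x => symbol_injective ε (by
      rw [symbol_pd, Algebra.algebraMap_eq_smul_one, map_smul, symbol_one, Derivation.map_smul,
        Derivation.map_one_eq_zero, smul_zero, map_zero])
    simp [h]
  · rw [LinearMap.smul_apply, Ad_apply, Algebra.commutes, sub_self, smul_zero,
      LinearMap.zero_apply]

/-- On symbols, `(1/ε) Ad` of a product of two generators is the same derivation for every `ε`,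
the value `ε = 0` included. This makes all the constructions below independent of `ε`. -/
lemma symbol_scaledAd_gen_mul_gen (ε : ℝ) (x y : Gen) (w : W ε) :
    symbol ε (scaledAd ε (gen ε x * gen ε y) w) = sym2 x y (symbol ε w) := by
  rw [scaledAd]
  split_ifs with h
  · subst h
    have hg : ∀ g v, symbol 0 (gen 0 g * v) = X g * symbol 0 v := fun g v => by
      rw [symbol_gen_mul, opM_apply]; simp
    have hp : ∀ z v, symbol 0 (pd 0 z (gen 0 x * gen 0 y) * v)
        = (if y = z then X x * symbol 0 v else 0) + (if x = z then X y * symbol 0 v else 0) := by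
      intro z v
      rw [pd_mul, pd_gen, pd_gen]
      split_ifs <;> simp [add_mul, hg]
    simp only [poisson, LinearMap.add_apply, LinearMap.sub_apply, LinearMap.comp_apply,
      LinearMap.mulLeft_apply, map_add, map_sub, hp, symbol_pd, sym2_apply, symD_apply, sum_gen]
    cases x <;> cases y <;> simp [bracket] <;> ring
  · rw [LinearMap.smul_apply, map_smul, symbol_Ad, smul_smul, inv_mul_cancel₀ (by exact_mod_cast h),
      one_smul]

/-- The derivation of symbols given by `(1/ε) Ad J_0`. -/
def dJ0 : Derivation ℂ (MvPolynomial Gen ℂ) (MvPolynomial Gen ℂ) :=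
  (1 / 2 : ℂ) • (sym2 Gen.ap Gen.am - sym2 Gen.bp Gen.bm)

/-- The derivation of symbols given by `(1/ε) Ad J_+`. -/
def dJp : Derivation ℂ (MvPolynomial Gen ℂ) (MvPolynomial Gen ℂ) := sym2 Gen.ap Gen.bm

/-- The derivation of symbols given by `(1/ε) Ad J_-`. -/
def dJm : Derivation ℂ (MvPolynomial Gen ℂ) (MvPolynomial Gen ℂ) := sym2 Gen.am Gen.bp

/-- The derivation of symbols given by `(1/ε) Ad K_0`. -/
def dK0 : Derivation ℂ (MvPolynomial Gen ℂ) (MvPolynomial Gen ℂ) :=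
  (1 / 2 : ℂ) • (sym2 Gen.ap Gen.am + sym2 Gen.bp Gen.bm)

lemma dJ0_apply (p : MvPolynomial Gen ℂ) : dJ0 p = (1 / 2 : ℂ) • (X Gen.ap * pderiv Gen.ap p
    - X Gen.am * pderiv Gen.am p - X Gen.bp * pderiv Gen.bp p + X Gen.bm * pderiv Gen.bm p) := by
  change (1 / 2 : ℂ) • (sym2 Gen.ap Gen.am p - sym2 Gen.bp Gen.bm p) = _
  congr 1
  simp only [sym2_apply, symD_apply, sum_gen, bracket]
  simp; ring

lemma dK0_apply (p : MvPolynomial Gen ℂ) : dK0 p = (1 / 2 : ℂ) • (X Gen.ap * pderiv Gen.ap p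
    - X Gen.am * pderiv Gen.am p + X Gen.bp * pderiv Gen.bp p - X Gen.bm * pderiv Gen.bm p) := by
  change (1 / 2 : ℂ) • (sym2 Gen.ap Gen.am p + sym2 Gen.bp Gen.bm p) = _
  congr 1
  simp only [sym2_apply, symD_apply, sum_gen, bracket]
  simp; ring

lemma dJp_apply (p : MvPolynomial Gen ℂ) :
    dJp p = X Gen.ap * pderiv Gen.bp p - X Gen.bm * pderiv Gen.am p := by
  rw [dJp]
  simp only [sym2_apply, symD_apply, sum_gen, bracket]
  simp; ring

lemma dJm_apply (p : MvPolynomial Gen ℂ) :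
    dJm p = X Gen.bp * pderiv Gen.ap p - X Gen.am * pderiv Gen.bm p := by
  rw [dJm]
  simp only [sym2_apply, symD_apply, sum_gen, bracket]
  simp; ring

lemma symbol_scaledAd_J0 (ε : ℝ) (w : W ε) :
    symbol ε (scaledAd ε (J0 ε) w) = dJ0 (symbol ε w) := by
  rw [← scaledAdₗ_apply, J0, map_smul, map_sub, LinearMap.smul_apply, LinearMap.sub_apply,
    map_smul, map_sub, scaledAdₗ_apply, scaledAdₗ_apply, symbol_scaledAd_gen_mul_gen,
    symbol_scaledAd_gen_mul_gen]
  rfl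

lemma symbol_scaledAd_K0 (ε : ℝ) (w : W ε) :
    symbol ε (scaledAd ε (K0 ε) w) = dK0 (symbol ε w) := by
  rw [← scaledAdₗ_apply, K0, map_smul, map_add, map_add, scaledAdₗ_apply ε (algebraMap _ _ _),
    scaledAd_algebraMap, add_zero, LinearMap.smul_apply, LinearMap.add_apply,
    map_smul, map_add, scaledAdₗ_apply, scaledAdₗ_apply, symbol_scaledAd_gen_mul_gen,
    symbol_scaledAd_gen_mul_gen]
  rfl

lemma symbol_scaledAd_Jp (ε : ℝ) (w : W ε) :
    symbol ε (scaledAd ε (Jp ε) w) = dJp (symbol ε w) := symbol_scaledAd_gen_mul_gen _ _ _ _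

lemma symbol_scaledAd_Jm (ε : ℝ) (w : W ε) :
    symbol ε (scaledAd ε (Jm ε) w) = dJm (symbol ε w) := symbol_scaledAd_gen_mul_gen _ _ _ _

lemma Ad_eq_smul_scaledAd (ε : ℝ) (T : W ε) : Ad ε T = (ε : ℂ) • scaledAd ε T := by
  by_cases h : ε = 0
  · subst h
    refine LinearMap.ext fun w => ?_
    rw [Ad_apply, W_zero_comm T w]
    simp
  · rw [scaledAd, if_neg h, smul_smul, mul_inv_cancel₀ (by exact_mod_cast h), one_smul]

lemma scaledAd_mul (ε : ℝ) (T v w : W ε) :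
    scaledAd ε T (v * w) = scaledAd ε T v * w + v * scaledAd ε T w := by
  rw [scaledAd]
  split_ifs with h
  · subst h
    have h1 : ∀ u x, u * (v * pd 0 x w) = v * (u * pd 0 x w) := fun u x => by
      rw [← mul_assoc, W_zero_comm u v, mul_assoc]
    simp only [poisson, LinearMap.add_apply, LinearMap.sub_apply, LinearMap.comp_apply,
      LinearMap.mulLeft_apply, pd_mul, mul_add, mul_sub, add_mul, sub_mul, h1, mul_assoc]
    abel
  · simp only [LinearMap.smul_apply, Ad_apply, smul_mul_assoc, mul_smul_comm, ← smul_add]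
    congr 1
    simp only [sub_mul, mul_sub, mul_assoc]
    abel

lemma casimir_eq (ε : ℝ) : casimir ε = ((ε : ℂ) ^ 2) • scaledCasimir ε := by
  rw [casimir, scaledCasimir]
  simp only [Ad_eq_smul_scaledAd, smul_mul_assoc, mul_smul_comm]
  module

/-! ### Commutation relations -/

lemma dJ0_dJm (p : MvPolynomial Gen ℂ) : dJ0 (dJm p) = dJm (dJ0 p) - dJm p := by
  have h : ⁅dJ0, dJm⁆ = -dJm := by
    refine derivation_ext fun z => ?_
    rw [Derivation.commutator_apply, Derivation.neg_apply]
    cases z <;> simp [dJ0_apply, dJm_apply, pderiv_X] <;> module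
  have := congrArg (fun d => d p) h
  simp only [Derivation.commutator_apply, Derivation.neg_apply] at this
  rw [sub_eq_iff_eq_add.1 this]; ring

lemma dJp_dJm (p : MvPolynomial Gen ℂ) : dJp (dJm p) = dJm (dJp p) + (2 : ℂ) • dJ0 p := by
  have h : ⁅dJp, dJm⁆ = (2 : ℂ) • dJ0 := by
    refine derivation_ext fun z => ?_
    rw [Derivation.commutator_apply, Derivation.smul_apply]
    cases z <;> simp [dJ0_apply, dJm_apply, dJp_apply, pderiv_X]
  have := congrArg (fun d => d p) h
  simp only [Derivation.commutator_apply, Derivation.smul_apply] at this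
  rw [sub_eq_iff_eq_add.1 this]; ring

lemma dK0_dJm (p : MvPolynomial Gen ℂ) : dK0 (dJm p) = dJm (dK0 p) := by
  have h : ⁅dK0, dJm⁆ = 0 := by
    refine derivation_ext fun z => ?_
    rw [Derivation.commutator_apply, Derivation.zero_apply]
    cases z <;> simp [dK0_apply, dJm_apply, pderiv_X]
  have := congrArg (fun d => d p) h
  rw [Derivation.commutator_apply] at this
  exact sub_eq_zero.1 this

lemma lap_dJm (p : MvPolynomial Gen ℂ) : lap (dJm p) = dJm (lap p) := by
  simp only [lap_apply, dJm_apply, map_sub, map_add, Derivation.leibniz, smul_eq_mul, pderiv_X]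
  simp [pderiv_symm Gen.bp Gen.ap, pderiv_symm Gen.bm Gen.ap, pderiv_symm Gen.bm Gen.am,
    pderiv_symm Gen.bm Gen.bp, pderiv_symm Gen.am Gen.ap]
  ring

lemma lap_dJp (p : MvPolynomial Gen ℂ) : lap (dJp p) = dJp (lap p) := by
  simp only [lap_apply, dJp_apply, map_sub, map_add, Derivation.leibniz, smul_eq_mul, pderiv_X]
  simp [pderiv_symm Gen.bp Gen.ap, pderiv_symm Gen.bm Gen.am,
    pderiv_symm Gen.bp Gen.am, pderiv_symm Gen.bm Gen.bp, pderiv_symm Gen.am Gen.ap]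
  ring

lemma lap_dJ0 (p : MvPolynomial Gen ℂ) : lap (dJ0 p) = dJ0 (lap p) := by
  have h : ∀ q, dJ0 q = (1 / 2 : ℂ) • (dJp (dJm q) - dJm (dJp q)) := fun q => by
    rw [dJp_dJm]; module
  rw [h, h, map_smul, map_sub, lap_dJp, lap_dJm, lap_dJm, lap_dJp]

lemma lap_dK0 (p : MvPolynomial Gen ℂ) : lap (dK0 p) = dK0 (lap p) := by
  rw [dK0_apply, dK0_apply, map_smul]
  congr 1
  simp only [lap_apply, map_sub, map_add, Derivation.leibniz, smul_eq_mul, pderiv_X]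
  simp [pderiv_symm Gen.bp Gen.ap, pderiv_symm Gen.bm Gen.ap, pderiv_symm Gen.bm Gen.am,
    pderiv_symm Gen.bp Gen.am, pderiv_symm Gen.bm Gen.bp, pderiv_symm Gen.am Gen.ap]
  ring

/-! ### Weights of monomials -/

/-- The label `(n, r, m)` of a monomial: half its degree and its eigenvalues under `(1/ε) Ad K_0`
and `(1/ε) Ad J_0`. -/
def weight (d : Gen →₀ ℕ) : ℝ × ℝ × ℝ :=
  (((d Gen.ap : ℝ) + d Gen.am + d Gen.bp + d Gen.bm) / 2,
    ((d Gen.ap : ℝ) - d Gen.am + d Gen.bp - d Gen.bm) / 2,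
    ((d Gen.ap : ℝ) - d Gen.am - d Gen.bp + d Gen.bm) / 2)

lemma admissible_weight (d : Gen →₀ ℕ) :
    Admissible (weight d).1 (weight d).2.1 (weight d).2.2 := by
  have h1 : (0 : ℝ) ≤ d Gen.ap := Nat.cast_nonneg _
  have h2 : (0 : ℝ) ≤ d Gen.am := Nat.cast_nonneg _
  have h3 : (0 : ℝ) ≤ d Gen.bp := Nat.cast_nonneg _
  have h4 : (0 : ℝ) ≤ d Gen.bm := Nat.cast_nonneg _
  refine ⟨⟨d Gen.ap + d Gen.am + d Gen.bp + d Gen.bm, ?_⟩, ⟨d Gen.ap + d Gen.bp, ?_⟩,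
    ⟨d Gen.ap + d Gen.bm, ?_⟩, abs_le.2 ⟨?_, ?_⟩, abs_le.2 ⟨?_, ?_⟩⟩ <;>
  simp only [weight] <;> push_cast <;> linarith

lemma weight_eq_iff {d e : Gen →₀ ℕ} : weight d = weight e ↔
    d Gen.ap + d Gen.bp = e Gen.ap + e Gen.bp ∧ d Gen.am + d Gen.bm = e Gen.am + e Gen.bm ∧
    d Gen.ap + d Gen.bm = e Gen.ap + e Gen.bm ∧ d Gen.am + d Gen.bp = e Gen.am + e Gen.bp := by
  simp only [weight, Prod.mk.injEq]
  constructor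
  · rintro ⟨h1, h2, h3⟩
    refine ⟨?_, ?_, ?_, ?_⟩ <;> rify <;> linarith
  · rintro ⟨h1, h2, h3, h4⟩
    rify at h1 h2 h3 h4
    refine ⟨?_, ?_, ?_⟩ <;> linarith

lemma coeff_X_mul_pderiv (x : Gen) (p : MvPolynomial Gen ℂ) (d : Gen →₀ ℕ) :
    coeff d (X x * pderiv x p) = d x * coeff d p := by
  rw [coeff_X_mul']
  split_ifs with h
  · have h1 := Finsupp.mem_support_iff.1 h
    have h2 : d - Finsupp.single x 1 + Finsupp.single x 1 = d :=
      Finsupp.sub_add_single_one_cancel h1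
    rw [coeff_pderiv, h2]
    have h3 := DFunLike.congr_fun h2 x
    rw [Finsupp.add_apply, Finsupp.single_eq_same] at h3
    rw [← h3]; push_cast; ring
  · rw [Finsupp.notMem_support_iff.1 h]; simp

/-- Half the Euler derivation, with eigenvalue `n` on homogeneous polynomials of degree `2n`. -/
def dN : Derivation ℂ (MvPolynomial Gen ℂ) (MvPolynomial Gen ℂ) :=
  (1 / 2 : ℂ) • mkDerivation ℂ X

lemma dN_apply (p : MvPolynomial Gen ℂ) : dN p = (1 / 2 : ℂ) • (X Gen.ap * pderiv Gen.ap p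
    + X Gen.am * pderiv Gen.am p + X Gen.bp * pderiv Gen.bp p + X Gen.bm * pderiv Gen.bm p) := by
  have h : (mkDerivation ℂ X : Derivation ℂ (MvPolynomial Gen ℂ) (MvPolynomial Gen ℂ))
      = (X Gen.ap : MvPolynomial Gen ℂ) • pderiv Gen.ap
        + (X Gen.am : MvPolynomial Gen ℂ) • pderiv Gen.am
        + (X Gen.bp : MvPolynomial Gen ℂ) • pderiv Gen.bp
        + (X Gen.bm : MvPolynomial Gen ℂ) • pderiv Gen.bm := by
    refine derivation_ext fun z => ?_
    cases z <;> simp [pderiv_X]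
  rw [dN, h]
  rfl

lemma dN_dJm (p : MvPolynomial Gen ℂ) : dN (dJm p) = dJm (dN p) := by
  have h : ⁅dN, dJm⁆ = 0 := by
    refine derivation_ext fun z => ?_
    rw [Derivation.commutator_apply, Derivation.zero_apply]
    cases z <;> simp [dN_apply, dJm_apply, pderiv_X]
  have := congrArg (fun d => d p) h
  rw [Derivation.commutator_apply] at this
  exact sub_eq_zero.1 this

lemma coeff_dN (p : MvPolynomial Gen ℂ) (d : Gen →₀ ℕ) :
    coeff d (dN p) = ((weight d).1 : ℂ) * coeff d p := by
  rw [dN_apply]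
  simp only [coeff_smul, coeff_add, coeff_X_mul_pderiv, weight, smul_eq_mul]
  push_cast; ring

lemma coeff_dK0 (p : MvPolynomial Gen ℂ) (d : Gen →₀ ℕ) :
    coeff d (dK0 p) = ((weight d).2.1 : ℂ) * coeff d p := by
  rw [dK0_apply]
  simp only [coeff_smul, coeff_add, coeff_sub, coeff_X_mul_pderiv, weight, smul_eq_mul]
  push_cast; ring

lemma coeff_dJ0 (p : MvPolynomial Gen ℂ) (d : Gen →₀ ℕ) :
    coeff d (dJ0 p) = ((weight d).2.2 : ℂ) * coeff d p := by
  rw [dJ0_apply]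
  simp only [coeff_smul, coeff_add, coeff_sub, coeff_X_mul_pderiv, weight, smul_eq_mul]
  push_cast; ring

lemma eq_smul_iff_of_coeff {p q : MvPolynomial Gen ℂ} {f : (Gen →₀ ℕ) → ℝ} {c : ℝ}
    (h : ∀ d, coeff d q = (f d : ℂ) * coeff d p) :
    q = (c : ℂ) • p ↔ ∀ d, coeff d p ≠ 0 → f d = c := by
  constructor
  · intro hq d hd
    have h1 := h d
    rw [hq, coeff_smul, smul_eq_mul] at h1
    exact_mod_cast (mul_right_cancel₀ hd h1).symm
  · intro hf
    ext d
    rw [h, coeff_smul, smul_eq_mul]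
    by_cases hd : coeff d p = 0
    · rw [hd, mul_zero, mul_zero]
    · rw [hf d hd]

/-- All monomials of `p` have the label `i`. -/
def HasWeight (i : ℝ × ℝ × ℝ) (p : MvPolynomial Gen ℂ) : Prop :=
  ∀ d, coeff d p ≠ 0 → weight d = i

lemma hasWeight_iff {n r m : ℝ} {p : MvPolynomial Gen ℂ} : HasWeight (n, r, m) p ↔
    dN p = (n : ℂ) • p ∧ dK0 p = (r : ℂ) • p ∧ dJ0 p = (m : ℂ) • p := by
  rw [eq_smul_iff_of_coeff (coeff_dN p), eq_smul_iff_of_coeff (coeff_dK0 p),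
    eq_smul_iff_of_coeff (coeff_dJ0 p)]
  constructor
  · intro h
    exact ⟨fun d hd => by rw [h d hd], fun d hd => by rw [h d hd], fun d hd => by rw [h d hd]⟩
  · rintro ⟨h1, h2, h3⟩ d hd
    exact Prod.ext (h1 d hd) (Prod.ext (h2 d hd) (h3 d hd))

lemma HasWeight.smul {i : ℝ × ℝ × ℝ} {p : MvPolynomial Gen ℂ} (c : ℂ) (h : HasWeight i p) :
    HasWeight i (c • p) := fun d hd => h d fun h0 => hd (by rw [coeff_smul, h0, smul_zero])

lemma HasWeight.sub {i : ℝ × ℝ × ℝ} {p q : MvPolynomial Gen ℂ} (hp : HasWeight i p)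
    (hq : HasWeight i q) : HasWeight i (p - q) := fun d hd => by
  by_cases h : coeff d p = 0
  · exact hq d fun h0 => hd (by rw [coeff_sub, h, h0, sub_zero])
  · exact hp d h

lemma HasWeight.dJm {n r m : ℝ} {p : MvPolynomial Gen ℂ} (h : HasWeight (n, r, m) p) :
    HasWeight (n, r, m - 1) (dJm p) := by
  rw [hasWeight_iff] at h ⊢
  obtain ⟨h1, h2, h3⟩ := h
  refine ⟨by rw [dN_dJm, h1, Derivation.map_smul], by rw [dK0_dJm, h2, Derivation.map_smul], ?_⟩
  rw [dJ0_dJm, h3, Derivation.map_smul]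
  push_cast
  module

lemma HasWeight.eq_zero {n r m : ℝ} {p : MvPolynomial Gen ℂ} (h : HasWeight (n, r, m) p)
    (ha : ¬ Admissible n r m) : p = 0 := by
  ext d
  by_contra hd
  have := admissible_weight d
  rw [h d hd] at this
  exact ha this

/-! ### Harmonic polynomials have at most one coefficient in each weight -/

lemma coeff_lap (p : MvPolynomial Gen ℂ) (e : Gen →₀ ℕ) : coeff e (lap p)
    = ((e Gen.ap + 1 : ℕ) * (e Gen.am + 1 : ℕ) : ℂ)
        * coeff (e + Finsupp.single Gen.ap 1 + Finsupp.single Gen.am 1) p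
      + ((e Gen.bp + 1 : ℕ) * (e Gen.bm + 1 : ℕ) : ℂ)
        * coeff (e + Finsupp.single Gen.bp 1 + Finsupp.single Gen.bm 1) p := by
  rw [lap_apply, coeff_add]
  simp only [coeff_pderiv]
  simp
  ring

/-- A harmonic polynomial which lacks one monomial lacks all the monomials of the same weight:
these form a chain, along which two letters `a_+ a_-` are exchanged for `b_+ b_-`, and the
Laplace equation relates each coefficient to the next one. -/
lemma coeff_eq_zero_of_weight_eq {p : MvPolynomial Gen ℂ} (hp : lap p = 0) {d d' : Gen →₀ ℕ}
    (hw : weight d = weight d') (hd : coeff d p = 0) : coeff d' p = 0 := by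
  have key : ∀ (k : ℕ) (d d' : Gen →₀ ℕ), weight d = weight d' → d Gen.ap = d' Gen.ap + k →
      (coeff d p = 0 ↔ coeff d' p = 0) := by
    intro k
    induction k with
    | zero =>
      intro d d' hw hk
      rw [weight_eq_iff] at hw
      have : d = d' := by ext g; cases g <;> omega
      rw [this]
    | succ k ih =>
      intro d d' hw hk
      have hw' := weight_eq_iff.1 hw
      set e := d - Finsupp.single Gen.ap 1 - Finsupp.single Gen.am 1 with he
      have hde : d = e + Finsupp.single Gen.ap 1 + Finsupp.single Gen.am 1 := by
        ext g
        cases g <;> simp [he] <;> omega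
      have hstep : coeff d p = 0 ↔
          coeff (e + Finsupp.single Gen.bp 1 + Finsupp.single Gen.bm 1) p = 0 := by
        have h := coeff_lap p e
        rw [hp, coeff_zero, ← hde] at h
        have h1 : ((e Gen.ap + 1 : ℕ) * (e Gen.am + 1 : ℕ) : ℂ) ≠ 0 :=
          mul_ne_zero (Nat.cast_ne_zero.2 (by omega)) (Nat.cast_ne_zero.2 (by omega))
        have h2 : ((e Gen.bp + 1 : ℕ) * (e Gen.bm + 1 : ℕ) : ℂ) ≠ 0 :=
          mul_ne_zero (Nat.cast_ne_zero.2 (by omega)) (Nat.cast_ne_zero.2 (by omega))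
        constructor
        · intro h0
          rw [h0, mul_zero, zero_add] at h
          exact (mul_eq_zero.1 h.symm).resolve_left h2
        · intro h0
          rw [h0, mul_zero, add_zero] at h
          exact (mul_eq_zero.1 h.symm).resolve_left h1
      rw [hstep]
      apply ih
      · rw [← hw, hde, weight_eq_iff]
        refine ⟨?_, ?_, ?_, ?_⟩ <;> simp <;> omega
      · have := congrArg (fun f => f Gen.ap) hde
        simp at this ⊢
        omega
  rcases le_total (d' Gen.ap) (d Gen.ap) with h | h
  · exact (key (d Gen.ap - d' Gen.ap) d d' hw (by omega)).1 hd
  · exact (key (d' Gen.ap - d Gen.ap) d' d hw.symm (by omega)).2 hd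

/-- Harmonic polynomials of a given weight are determined up to a factor. -/
lemma exists_eq_smul {i : ℝ × ℝ × ℝ} {p q : MvPolynomial Gen ℂ} (hp : lap p = 0) (hq : lap q = 0)
    (wp : HasWeight i p) (wq : HasWeight i q) (hq0 : q ≠ 0) : ∃ c : ℂ, p = c • q := by
  obtain ⟨d, hd⟩ := ne_zero_iff.1 hq0
  refine ⟨coeff d p / coeff d q, ?_⟩
  have h0 : coeff d (p - (coeff d p / coeff d q) • q) = 0 := by
    rw [coeff_sub, coeff_smul, smul_eq_mul, div_mul_cancel₀ _ hd, sub_self]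
  have hl : lap (p - (coeff d p / coeff d q) • q) = 0 := by
    rw [map_sub, map_smul, hp, hq, smul_zero, sub_zero]
  rw [← sub_eq_zero]
  ext d'
  by_contra hd'
  refine hd' (coeff_eq_zero_of_weight_eq hl ?_ h0)
  rw [wq d hd, (wp.sub (wq.smul _)) d' hd']

/-! ### The multiplets generated from highest weight vectors -/

/-- The symbol of `((1/ε) Ad J_-)^k (a_+^i b_-^j)`. -/
def ladder (i j k : ℕ) : MvPolynomial Gen ℂ :=
  (dJm : MvPolynomial Gen ℂ → MvPolynomial Gen ℂ)^[k] (X Gen.ap ^ i * X Gen.bm ^ j)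

lemma ladder_succ (i j k : ℕ) : ladder i j (k + 1) = dJm (ladder i j k) :=
  Function.iterate_succ_apply' _ _ _

lemma lap_ladder (i j k : ℕ) : lap (ladder i j k) = 0 := by
  induction k with
  | zero =>
    simp [ladder, lap_apply, Derivation.leibniz, Derivation.leibniz_pow, pderiv_X]
  | succ k ih => rw [ladder_succ, lap_dJm, ih, Derivation.map_zero]

lemma hasWeight_ladder (i j k : ℕ) :
    HasWeight (((i : ℝ) + j) / 2, ((i : ℝ) - j) / 2, ((i : ℝ) + j) / 2 - k) (ladder i j k) := by
  induction k with
  | zero =>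
    intro d hd
    rw [ladder, Function.iterate_zero, id, X_pow_eq_monomial, X_pow_eq_monomial, monomial_mul,
      coeff_monomial] at hd
    have h : Finsupp.single Gen.ap i + Finsupp.single Gen.bm j = d := by
      by_contra h; exact hd (if_neg h)
    rw [← h]
    simp [weight]
  | succ k ih =>
    rw [ladder_succ]
    have := ih.dJm
    push_cast
    rwa [← sub_sub]

lemma dJ0_ladder (i j k : ℕ) :
    dJ0 (ladder i j k) = (((i : ℂ) + j) / 2 - k) • ladder i j k := by
  have := (hasWeight_iff.1 (hasWeight_ladder i j k)).2.2
  rw [this]; push_cast; rfl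

lemma dJp_ladder_zero (i j : ℕ) : dJp (ladder i j 0) = 0 := by
  simp [ladder, dJp_apply, Derivation.leibniz, Derivation.leibniz_pow, pderiv_X]

/-- The `sl₂` ladder relation, by induction with `[J_+, J_-] = 2 J_0`. -/
lemma dJp_ladder_succ (i j k : ℕ) :
    dJp (ladder i j (k + 1)) = (((k : ℂ) + 1) * (i + j - k)) • ladder i j k := by
  induction k with
  | zero =>
    rw [ladder_succ, dJp_dJm, dJp_ladder_zero, Derivation.map_zero, dJ0_ladder]
    push_cast
    module
  | succ k ih =>
    rw [ladder_succ, dJp_dJm, ih, Derivation.map_smul, ← ladder_succ, dJ0_ladder]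
    push_cast
    module

lemma dJm_dJp_ladder (i j k : ℕ) :
    dJm (dJp (ladder i j k)) = ((k : ℂ) * (i + j - k + 1)) • ladder i j k := by
  cases k with
  | zero => rw [dJp_ladder_zero, Derivation.map_zero]; simp
  | succ k =>
    rw [dJp_ladder_succ, Derivation.map_smul, ← ladder_succ]
    push_cast
    module

lemma ladder_ne_zero {i j k : ℕ} (hk : k ≤ i + j) : ladder i j k ≠ 0 := by
  induction k with
  | zero => exact mul_ne_zero (pow_ne_zero _ (X_ne_zero _)) (pow_ne_zero _ (X_ne_zero _))
  | succ k ih =>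
    intro h
    have h1 := dJp_ladder_succ i j k
    rw [h, Derivation.map_zero] at h1
    refine ih (by omega) ((smul_eq_zero.1 h1.symm).resolve_left (mul_ne_zero ?_ ?_))
    · exact_mod_cast Nat.succ_ne_zero k
    · intro h2
      have : ((i + j : ℕ) : ℂ) = (k : ℕ) := by push_cast; exact sub_eq_zero.1 h2
      have := Nat.cast_injective this
      omega

/-- The vector below the lowest weight vanishes, because no monomial has its weight. -/
lemma ladder_top (i j : ℕ) : ladder i j (i + j + 1) = 0 := by
  refine (hasWeight_ladder i j (i + j + 1)).eq_zero ?_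
  rintro ⟨-, -, -, -, h⟩
  have h1 := (abs_le.1 h).1
  push_cast at h1
  linarith

/-! ### The elements `P(n, r, m)` -/

/-- The admissible labels in terms of natural numbers: `i = n + r` and `j = n - r` are the exponents
of the highest weight vector, and `k = n - m` counts the applications of `J_-`. -/
lemma admissible_iff {n r m : ℝ} : Admissible n r m ↔ ∃ i j k : ℕ, k ≤ i + j ∧
    n = ((i : ℝ) + j) / 2 ∧ r = ((i : ℝ) - j) / 2 ∧ m = ((i : ℝ) + j) / 2 - k := by
  constructor
  · rintro ⟨⟨a, ha⟩, ⟨b, hb⟩, ⟨c, hc⟩, hr, hm⟩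
    rw [abs_le] at hr hm
    have h1 : (0 : ℤ) ≤ b := by rify; linarith
    have h2 : (0 : ℤ) ≤ a - b := by rify; linarith
    have h3 : (0 : ℤ) ≤ a - c := by rify; linarith
    have h4 : (0 : ℤ) ≤ c := by rify; linarith
    obtain ⟨i, rfl⟩ := Int.eq_ofNat_of_zero_le h1
    obtain ⟨j, hj⟩ := Int.eq_ofNat_of_zero_le h2
    obtain ⟨k, hk⟩ := Int.eq_ofNat_of_zero_le h3
    refine ⟨i, j, k, by omega, ?_⟩
    rify at hj hk
    push_cast at hb
    refine ⟨?_, ?_, ?_⟩ <;> linarith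
  · rintro ⟨i, j, k, hk, rfl, rfl, rfl⟩
    rify at hk
    have hi : (0 : ℝ) ≤ i := Nat.cast_nonneg _
    have hj : (0 : ℝ) ≤ j := Nat.cast_nonneg _
    have hk' : (0 : ℝ) ≤ k := Nat.cast_nonneg _
    refine ⟨⟨i + j, ?_⟩, ⟨i, ?_⟩, ⟨i + j - k, ?_⟩, abs_le.2 ⟨?_, ?_⟩, abs_le.2 ⟨?_, ?_⟩⟩ <;>
      push_cast <;> linarith

/-- The normalisation `((N-k)! / (N! k!))^(1/2)` of `P(n, r, m)`, with `N = 2n` and `k = n - m`. -/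
def normCoeff (N k : ℕ) : ℝ :=
  Real.sqrt (((N - k).factorial : ℝ) / (N.factorial * k.factorial))

lemma normCoeff_ne_zero (N k : ℕ) : normCoeff N k ≠ 0 := by
  rw [normCoeff]
  positivity

lemma normCoeff_eq {N k : ℕ} (hk : k < N) : normCoeff N k
    = Real.sqrt ((N : ℝ) - k) * Real.sqrt (k + 1) * normCoeff N (k + 1) := by
  obtain ⟨l, rfl⟩ := Nat.exists_eq_add_of_lt hk
  have h1 : k + l + 1 - k = l + 1 := by omega
  have h2 : k + l + 1 - (k + 1) = l := by omega
  have h3 : ((k + l + 1 : ℕ) : ℝ) - k = l + 1 := by push_cast; ring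
  rw [normCoeff, normCoeff, h1, h2, h3, ← Real.sqrt_mul (by positivity),
    ← Real.sqrt_mul (by positivity), Nat.factorial_succ l, Nat.factorial_succ k]
  congr 1
  push_cast
  field_simp

lemma symbol_P (ε : ℝ) {i j k : ℕ} (hk : k ≤ i + j) :
    symbol ε (P ε (((i : ℝ) + j) / 2) (((i : ℝ) - j) / 2) (((i : ℝ) + j) / 2 - k))
      = (normCoeff (i + j) k : ℂ) • ladder i j k := by
  have h1 : ((i : ℝ) + j) / 2 + (((i : ℝ) + j) / 2 - k) = (i + j - k : ℕ) := by
    push_cast [hk]; ring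
  have h2 : 2 * (((i : ℝ) + j) / 2) = (i + j : ℕ) := by push_cast; ring
  have h3 : ((i : ℝ) + j) / 2 - (((i : ℝ) + j) / 2 - k) = k := by ring
  have h4 : ((i : ℝ) + j) / 2 + ((i : ℝ) - j) / 2 = i := by ring
  have h5 : ((i : ℝ) + j) / 2 - ((i : ℝ) - j) / 2 = j := by ring
  rw [P, h1, h2, h3, h4, h5]
  simp only [Nat.floor_natCast]
  rw [map_smul, normCoeff]
  congr 1
  have hb : ∀ l, symbol ε (gen ε Gen.bm ^ l) = X Gen.bm ^ l := by
    intro l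
    induction l with
    | zero => simp [symbol_one]
    | succ l ih =>
      rw [pow_succ', symbol_gen_mul, ih, opM_apply, pow_succ']
      simp [symD_apply, sum_gen, bracket, Derivation.leibniz_pow, pderiv_X]
  have ha : ∀ l, symbol ε (gen ε Gen.ap ^ l * gen ε Gen.bm ^ j)
      = X Gen.ap ^ l * X Gen.bm ^ j := by
    intro l
    induction l with
    | zero => simp [hb]
    | succ l ih =>
      rw [pow_succ', mul_assoc, symbol_gen_mul, ih, opM_apply, pow_succ', mul_assoc]
      simp [symD_apply, sum_gen, bracket, Derivation.leibniz, Derivation.leibniz_pow, pderiv_X]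
  induction k with
  | zero => simp [ha, ladder]
  | succ k ih =>
    rw [pow_succ', Module.End.mul_apply, symbol_scaledAd_Jm, ladder_succ]
    congr 1
    exact ih (by omega) (by push_cast [show k ≤ i + j by omega]; ring) (by ring)

lemma symbol_P_of_admissible (ε : ℝ) {n r m : ℝ} (h : Admissible n r m) :
    ∃ i j k : ℕ, k ≤ i + j ∧ n = ((i : ℝ) + j) / 2 ∧ r = ((i : ℝ) - j) / 2 ∧
      m = ((i : ℝ) + j) / 2 - k ∧
      symbol ε (P ε n r m) = (normCoeff (i + j) k : ℂ) • ladder i j k := by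
  obtain ⟨i, j, k, hk, rfl, rfl, rfl⟩ := admissible_iff.1 h
  exact ⟨i, j, k, hk, rfl, rfl, rfl, symbol_P ε hk⟩

lemma hasWeight_symbol_P (ε : ℝ) {n r m : ℝ} (h : Admissible n r m) :
    HasWeight (n, r, m) (symbol ε (P ε n r m)) := by
  obtain ⟨i, j, k, hk, rfl, rfl, rfl, hs⟩ := symbol_P_of_admissible ε h
  rw [hs]
  exact (hasWeight_ladder i j k).smul _

lemma lap_symbol_P (ε : ℝ) {n r m : ℝ} (h : Admissible n r m) :
    lap (symbol ε (P ε n r m)) = 0 := by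
  obtain ⟨i, j, k, hk, rfl, rfl, rfl, hs⟩ := symbol_P_of_admissible ε h
  rw [hs, map_smul, lap_ladder, smul_zero]

lemma symbol_P_ne_zero (ε : ℝ) {n r m : ℝ} (h : Admissible n r m) :
    symbol ε (P ε n r m) ≠ 0 := by
  obtain ⟨i, j, k, hk, rfl, rfl, rfl, hs⟩ := symbol_P_of_admissible ε h
  rw [hs]
  exact smul_ne_zero (by exact_mod_cast normCoeff_ne_zero _ _) (ladder_ne_zero hk)

lemma P_mem_Psi (ε : ℝ) {n r m : ℝ} (h : Admissible n r m) : P ε n r m ∈ Psi ε :=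
  mem_Psi_iff.2 (lap_symbol_P ε h)

lemma symbol_P_eq (ε ε' : ℝ) {n r m : ℝ} (h : Admissible n r m) :
    symbol ε (P ε n r m) = symbol ε' (P ε' n r m) := by
  obtain ⟨i, j, k, hk, rfl, rfl, rfl⟩ := admissible_iff.1 h
  rw [symbol_P ε hk, symbol_P ε' hk]

/-! ### Eigenvalue and ladder equations -/

lemma scaledAd_J0_P (ε : ℝ) {n r m : ℝ} (h : Admissible n r m) :
    scaledAd ε (J0 ε) (P ε n r m) = (m : ℂ) • P ε n r m := symbol_injective ε (by
  rw [symbol_scaledAd_J0, map_smul, (hasWeight_iff.1 (hasWeight_symbol_P ε h)).2.2])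

lemma scaledAd_K0_P (ε : ℝ) {n r m : ℝ} (h : Admissible n r m) :
    scaledAd ε (K0 ε) (P ε n r m) = (r : ℂ) • P ε n r m := symbol_injective ε (by
  rw [symbol_scaledAd_K0, map_smul, (hasWeight_iff.1 (hasWeight_symbol_P ε h)).2.1])

lemma scaledCasimir_P (ε : ℝ) {n r m : ℝ} (h : Admissible n r m) :
    scaledCasimir ε (P ε n r m) = ((n * (n + 1) : ℝ) : ℂ) • P ε n r m := by
  apply symbol_injective ε
  obtain ⟨i, j, k, hk, rfl, rfl, rfl, hs⟩ := symbol_P_of_admissible ε h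
  simp only [scaledCasimir, LinearMap.add_apply, LinearMap.smul_apply, Module.End.mul_apply,
    map_add, map_smul, symbol_scaledAd_J0, symbol_scaledAd_Jp, symbol_scaledAd_Jm, hs,
    Derivation.map_smul, dJp_dJm, dJm_dJp_ladder, dJ0_ladder]
  push_cast
  module

lemma scaledAd_Jm_P (ε : ℝ) {n r m : ℝ} (h : Admissible n r m) :
    scaledAd ε (Jm ε) (P ε n r m) =
      ((Real.sqrt (n + m) * Real.sqrt (n - m + 1) : ℝ) : ℂ) • P ε n r (m - 1) := by
  apply symbol_injective ε
  obtain ⟨i, j, k, hk, rfl, rfl, rfl, hs⟩ := symbol_P_of_admissible ε h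
  have h1 : ((i : ℝ) + j) / 2 + (((i : ℝ) + j) / 2 - k) = ((i + j : ℕ) : ℝ) - k := by
    push_cast; ring
  have h2 : ((i : ℝ) + j) / 2 - (((i : ℝ) + j) / 2 - k) + 1 = k + 1 := by ring
  rw [symbol_scaledAd_Jm, hs, Derivation.map_smul, ← ladder_succ, map_smul, h1, h2]
  rcases hk.lt_or_eq with hk | rfl
  · have h3 : ((i : ℝ) + j) / 2 - k - 1 = ((i : ℝ) + j) / 2 - (k + 1 : ℕ) := by push_cast; ring
    rw [h3, symbol_P ε (by omega : k + 1 ≤ i + j), smul_smul, normCoeff_eq hk]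
    push_cast
    rfl
  · rw [ladder_top]
    simp

lemma scaledAd_Jp_P (ε : ℝ) {n r m : ℝ} (h : Admissible n r m) :
    scaledAd ε (Jp ε) (P ε n r m) =
      ((Real.sqrt (n - m) * Real.sqrt (n + m + 1) : ℝ) : ℂ) • P ε n r (m + 1) := by
  apply symbol_injective ε
  obtain ⟨i, j, k, hk, rfl, rfl, rfl, hs⟩ := symbol_P_of_admissible ε h
  rw [symbol_scaledAd_Jp, hs, Derivation.map_smul, map_smul]
  cases k with
  | zero =>
    rw [dJp_ladder_zero]
    simp
  | succ k =>
    have h1 : ((i : ℝ) + j) / 2 + (((i : ℝ) + j) / 2 - (k + 1 : ℕ)) + 1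
        = ((i + j : ℕ) : ℝ) - k := by push_cast; ring
    have h2 : ((i : ℝ) + j) / 2 - (((i : ℝ) + j) / 2 - (k + 1 : ℕ)) = k + 1 := by push_cast; ring
    have h3 : ((i : ℝ) + j) / 2 - (k + 1 : ℕ) + 1 = ((i : ℝ) + j) / 2 - k := by push_cast; ring
    have hle : (0 : ℝ) ≤ ((i + j : ℕ) : ℝ) - k := by
      rw [sub_nonneg]; exact_mod_cast (by omega : k ≤ i + j)
    rw [h1, h2, h3, symbol_P ε (by omega : k ≤ i + j), dJp_ladder_succ, smul_smul, smul_smul,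
      normCoeff_eq (by omega : k < i + j)]
    congr 1
    have e1 := Real.mul_self_sqrt hle
    have e2 := Real.mul_self_sqrt (by positivity : (0 : ℝ) ≤ (k : ℝ) + 1)
    have e3 : normCoeff (i + j) (k + 1) * (((k : ℝ) + 1) * (i + j - k))
        = Real.sqrt (k + 1) * Real.sqrt (((i + j : ℕ) : ℝ) - k)
          * (Real.sqrt (((i + j : ℕ) : ℝ) - k) * Real.sqrt (k + 1)
            * normCoeff (i + j) (k + 1)) := by
      have e4 : (i : ℝ) + j - k = ((i + j : ℕ) : ℝ) - k := by push_cast; ring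
      rw [e4]
      calc _ = normCoeff (i + j) (k + 1) * ((Real.sqrt (k + 1) * Real.sqrt (k + 1))
            * (Real.sqrt (((i + j : ℕ) : ℝ) - k) * Real.sqrt (((i + j : ℕ) : ℝ) - k))) := by
            rw [e1, e2]
        _ = _ := by ring
    exact_mod_cast e3

/-! ### Coefficients in the basis of symmetric polynomials -/

lemma coeff_symbol (ε : ℝ) (w : W ε) (s : Multiset Gen) :
    coeff (Multiset.toFinsupp s) (symbol ε w) = (symBasis ε).repr w s * nWords s := by
  have h : (lcoeff ℂ (Multiset.toFinsupp s)) ∘ₗ symbol ε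
      = (nWords s : ℂ) • (Finsupp.lapply s ∘ₗ (symBasis ε).repr.toLinearMap) := by
    refine (symBasis ε).ext fun t => ?_
    rw [symBasis_apply]
    simp only [LinearMap.comp_apply, LinearMap.smul_apply, lcoeff_apply, symbol_S, coeff_smul,
      LinearEquiv.coe_coe, Finsupp.lapply_apply, smul_eq_mul]
    rw [← symBasis_apply, Module.Basis.repr_self, mon, coeff_monomial]
    by_cases hst : t = s
    · subst hst; simp
    · rw [if_neg (fun h => hst (Multiset.toFinsupp.injective h)), Finsupp.single_apply,
        if_neg hst, mul_zero, mul_zero]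
  have := congrArg (fun f => f w) h
  simp only [LinearMap.comp_apply, LinearMap.smul_apply, lcoeff_apply,
      LinearEquiv.coe_coe, Finsupp.lapply_apply, smul_eq_mul] at this
  rw [this, mul_comm]

lemma repr_eq_of_symbol_eq {ε ε' : ℝ} {w : W ε} {w' : W ε'} (h : symbol ε w = symbol ε' w') :
    (symBasis ε).repr w = (symBasis ε').repr w' := by
  ext s
  have h1 := coeff_symbol ε w s
  rw [h, coeff_symbol] at h1
  exact (mul_right_cancel₀ (Nat.cast_ne_zero.2 (nWords_pos s).ne') h1).symm

lemma pi0_eq (ε : ℝ) (w : W ε) : pi0 ε w = coeff 0 (symbol ε w) := by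
  have h := coeff_symbol ε w 0
  have h1 : nWords 0 = 1 := by simpa using nWords_mul 0
  rw [h1, map_zero] at h
  rw [h, pi0, Nat.cast_one, mul_one]

lemma mem_Wn_iff {ε n : ℝ} {w : W ε} :
    w ∈ Wn ε n ↔ ∀ d, coeff d (symbol ε w) ≠ 0 → (weight d).1 = n := by
  have h : ∀ s : Multiset Gen, ((s.card : ℝ) = 2 * n ↔ (weight (Multiset.toFinsupp s)).1 = n) := by
    intro s
    have h1 : s.card = s.count Gen.ap + (s.count Gen.am + (s.count Gen.bp + s.count Gen.bm)) := by
      rw [← Multiset.sum_count_eq_card (s := Finset.univ) (m := s) (fun a _ => Finset.mem_univ a),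
        sum_gen]
    rw [h1]
    simp only [weight, Multiset.toFinsupp_apply]
    push_cast
    constructor <;> intro h <;> linarith
  have hS : S ε = ⇑(symBasis ε) := funext fun s => (symBasis_apply ε s).symm
  rw [Wn, hS, Module.Basis.mem_span_image]
  constructor
  · intro hw d hd
    have hc := coeff_symbol ε w (Finsupp.toMultiset d)
    rw [Finsupp.toMultiset_toFinsupp] at hc
    have := hw (Finsupp.mem_support_iff.2 fun h0 => hd (by rw [hc, h0, zero_mul]))
    have := (h _).1 this
    rwa [Finsupp.toMultiset_toFinsupp] at this
  · intro hw s hs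
    refine (h s).2 (hw _ ?_)
    rw [coeff_symbol]
    exact mul_ne_zero (Finsupp.mem_support_iff.1 hs) (Nat.cast_ne_zero.2 (nWords_pos s).ne')

lemma P_mem_PsiDeg (ε : ℝ) {n r m : ℝ} (h : Admissible n r m) : P ε n r m ∈ PsiDeg ε n :=
  ⟨P_mem_Psi ε h, mem_Wn_iff.2 fun d hd => by rw [hasWeight_symbol_P ε h d hd]⟩

/-! ### The joint eigenspaces -/

/-- On symbols the joint eigenspaces are the harmonic polynomials of a given weight. -/
lemma mem_joint_iff {ε n r m : ℝ} {w : W ε} : w ∈ PsiDeg ε n ⊓ PsiK ε r ⊓ PsiJ ε m ↔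
    lap (symbol ε w) = 0 ∧ HasWeight (n, r, m) (symbol ε w) := by
  have hK : w ∈ LinearMap.ker (scaledAd ε (K0 ε) - (r : ℂ) • 1) ↔
      dK0 (symbol ε w) = (r : ℂ) • symbol ε w := by
    rw [← symbol_scaledAd_K0, ← map_smul, (symbol_injective ε).eq_iff, LinearMap.mem_ker,
      LinearMap.sub_apply, sub_eq_zero]
    rfl
  have hJ : w ∈ LinearMap.ker (scaledAd ε (J0 ε) - (m : ℂ) • 1) ↔
      dJ0 (symbol ε w) = (m : ℂ) • symbol ε w := by
    rw [← symbol_scaledAd_J0, ← map_smul, (symbol_injective ε).eq_iff, LinearMap.mem_ker,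
      LinearMap.sub_apply, sub_eq_zero]
    rfl
  rw [hasWeight_iff, eq_smul_iff_of_coeff (coeff_dN _), PsiDeg, PsiK, PsiJ]
  simp only [Submodule.mem_inf, mem_Wn_iff, mem_Psi_iff, hK, hJ]
  tauto

lemma joint_eq_span (ε : ℝ) {n r m : ℝ} (h : Admissible n r m) :
    PsiDeg ε n ⊓ PsiK ε r ⊓ PsiJ ε m = Submodule.span ℂ {P ε n r m} := by
  refine le_antisymm (fun w hw => ?_) (Submodule.span_le.2 ?_)
  · rw [mem_joint_iff] at hw
    obtain ⟨c, hc⟩ := exists_eq_smul hw.1 (lap_symbol_P ε h) hw.2 (hasWeight_symbol_P ε h)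
      (symbol_P_ne_zero ε h)
    rw [← map_smul] at hc
    rw [symbol_injective ε hc]
    exact Submodule.smul_mem _ _ (Submodule.mem_span_singleton_self _)
  · rw [Set.singleton_subset_iff]
    exact mem_joint_iff.2 ⟨lap_symbol_P ε h, hasWeight_symbol_P ε h⟩

lemma finrank_joint (ε : ℝ) {n r m : ℝ} (h : Admissible n r m) :
    Module.finrank ℂ ↥(PsiDeg ε n ⊓ PsiK ε r ⊓ PsiJ ε m) = 1 := by
  rw [joint_eq_span ε h]
  exact finrank_span_singleton fun h0 => symbol_P_ne_zero ε h (by rw [h0, map_zero])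

lemma joint_eq_bot (ε : ℝ) {n r m : ℝ} (h : ¬ Admissible n r m) :
    PsiDeg ε n ⊓ PsiK ε r ⊓ PsiJ ε m = ⊥ := by
  rw [Submodule.eq_bot_iff]
  intro w hw
  rw [mem_joint_iff] at hw
  exact symbol_injective ε (by rw [hw.2.eq_zero h, map_zero])

/-! ### Bases -/

/-- A family with a dual family of functionals, up to factors, is a basis as soon as the
functionals separate points and only finitely many of them are nonzero on each vector. -/
lemma exists_basis_of_dual {ι K M : Type*} [Field K] [AddCommGroup M] [Module K M]
    (V : Submodule K M) (v : ι → M) (hv : ∀ i, v i ∈ V) (φ : ι → M →ₗ[K] K)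
    (h1 : ∀ i, φ i (v i) ≠ 0) (h2 : ∀ i j, i ≠ j → φ j (v i) = 0)
    (hfin : ∀ w ∈ V, {i | φ i w ≠ 0}.Finite) (h0 : ∀ w ∈ V, (∀ i, φ i w = 0) → w = 0) :
    ∃ b : Module.Basis ι K V, ∀ i, (b i : M) = v i := by
  classical
  have hsum : ∀ (s : Finset ι) (c : ι → K) (j : ι),
      φ j (∑ i ∈ s, c i • v i) = if j ∈ s then c j * φ j (v j) else 0 := by
    intro s c j
    rw [map_sum]
    simp only [map_smul, smul_eq_mul]
    split_ifs with hj
    · rw [Finset.sum_eq_single_of_mem j hj fun i _ hij => by rw [h2 i j hij, mul_zero]]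
    · refine Finset.sum_eq_zero fun i hi => ?_
      rw [h2 i j (by rintro rfl; exact hj hi), mul_zero]
  have hli : LinearIndependent K v := by
    rw [linearIndependent_iff']
    intro s c hc i hi
    have := hsum s c i
    rw [hc, map_zero, if_pos hi] at this
    exact (mul_eq_zero.1 this.symm).resolve_right (h1 i)
  have hli' : LinearIndependent K (fun i => (⟨v i, hv i⟩ : V)) :=
    LinearIndependent.of_comp V.subtype hli
  refine ⟨Module.Basis.mk hli' ?_, fun i => by rw [Module.Basis.mk_apply]⟩
  rintro ⟨w, hw⟩ -
  set s := (hfin w hw).toFinset with hs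
  have hmem : w - ∑ i ∈ s, (φ i w / φ i (v i)) • v i ∈ V :=
    V.sub_mem hw (V.sum_mem fun i _ => V.smul_mem _ (hv i))
  have hz := h0 _ hmem fun j => by
    rw [map_sub, hsum]
    split_ifs with hj
    · rw [div_mul_cancel₀ _ (h1 j), sub_self]
    · rw [sub_zero]
      by_contra hne
      exact hj ((Set.Finite.mem_toFinset _).2 hne)
  have he : (⟨w, hw⟩ : V) = ∑ i ∈ s, (φ i w / φ i (v i)) • (⟨v i, hv i⟩ : V) := by
    apply Subtype.ext
    refine (sub_eq_zero.1 hz).trans ?_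
    simp
  rw [he]
  exact Submodule.sum_mem _ fun i _ =>
    Submodule.smul_mem _ _ (Submodule.subset_span ⟨i, rfl⟩)

/-- A family of the `P(n, r, m)` with distinct labels is a basis of every space of traceless
elements which contains it and whose monomials only have labels from the family: one monomial for
each label yields the dual functionals. -/
lemma exists_basis_P {ι : Type*} (ε : ℝ) (l : ι → ℝ × ℝ × ℝ) (hl : Function.Injective l)
    (ha : ∀ i, Admissible (l i).1 (l i).2.1 (l i).2.2) (V : Submodule ℂ (W ε)) (hV : V ≤ Psi ε)
    (hP : ∀ i, P ε (l i).1 (l i).2.1 (l i).2.2 ∈ V)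
    (hw : ∀ w ∈ V, ∀ d, coeff d (symbol ε w) ≠ 0 → ∃ i, l i = weight d) :
    ∃ b : Module.Basis ι ℂ V, ∀ i, (b i : W ε) = P ε (l i).1 (l i).2.1 (l i).2.2 := by
  choose d hd using fun i => ne_zero_iff.1 (symbol_P_ne_zero ε (ha i))
  have hwd : ∀ i, weight (d i) = l i := fun i => hasWeight_symbol_P ε (ha i) _ (hd i)
  refine exists_basis_of_dual V _ hP (fun i => lcoeff ℂ (d i) ∘ₗ symbol ε) hd ?_ ?_ ?_
  · intro i j hij
    by_contra h
    have := hasWeight_symbol_P ε (ha i) (d j) h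
    rw [hwd] at this
    exact hij (hl this.symm)
  · intro w _
    have hinj : Function.Injective d := fun i j hij => hl (by rw [← hwd, ← hwd, hij])
    refine ((symbol ε w).support.finite_toSet.preimage hinj.injOn).subset fun i hi => ?_
    exact mem_support_iff.2 hi
  · intro w hwV h
    apply symbol_injective ε
    rw [map_zero]
    ext e
    by_contra he
    obtain ⟨i, hi⟩ := hw w hwV e he
    exact he (coeff_eq_zero_of_weight_eq (mem_Psi_iff.1 (hV hwV)) ((hwd i).trans hi) (h i))

/-! ### The conjugation on symbols -/

/-- The conjugation of symbols: complex conjugation of the coefficients together with the exchange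
of `a_+` with `a_-` and of `b_+` with `b_-`. -/
def symDagger : MvPolynomial Gen ℂ →+* MvPolynomial Gen ℂ :=
  eval₂Hom (C.comp (starRingEnd ℂ)) fun g => X (conjGen g)

lemma symDagger_X (g : Gen) : symDagger (X g) = X (conjGen g) := by simp [symDagger]

lemma symDagger_C (c : ℂ) : symDagger (C c) = C (starRingEnd ℂ c) := by simp [symDagger]

lemma symDagger_smul (c : ℂ) (p : MvPolynomial Gen ℂ) :
    symDagger (c • p) = starRingEnd ℂ c • symDagger p := by
  rw [smul_eq_C_mul, map_mul, symDagger_C, ← smul_eq_C_mul]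

lemma conjGen_conjGen (g : Gen) : conjGen (conjGen g) = g := by cases g <;> rfl

lemma symDagger_pderiv (x : Gen) (p : MvPolynomial Gen ℂ) :
    symDagger (pderiv x p) = pderiv (conjGen x) (symDagger p) := by
  induction p using MvPolynomial.induction_on with
  | C c => simp [symDagger_C]
  | add p q hp hq => rw [map_add, map_add, map_add, map_add, hp, hq]
  | mul_X p g hp =>
    rw [map_mul symDagger, Derivation.leibniz, Derivation.leibniz, map_add, smul_eq_mul,
      smul_eq_mul, map_mul, map_mul, hp, symDagger_X, pderiv_X, pderiv_X, smul_eq_mul, smul_eq_mul]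
    have h : symDagger (Pi.single (M := fun _ => MvPolynomial Gen ℂ) x 1 g)
        = Pi.single (M := fun _ => MvPolynomial Gen ℂ) (conjGen x) 1 (conjGen g) := by
      cases x <;> cases g <;> simp [conjGen]
    rw [h]

lemma symDagger_symD (x : Gen) (p : MvPolynomial Gen ℂ) :
    symDagger (symD x p) = -symD (conjGen x) (symDagger p) := by
  cases x <;> simp [symD_apply, sum_gen, bracket, conjGen, symDagger_pderiv]

lemma symDagger_lap (p : MvPolynomial Gen ℂ) : symDagger (lap p) = lap (symDagger p) := by
  rw [lap_apply, lap_apply, map_add]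
  simp only [symDagger_pderiv, conjGen]
  rw [pderiv_symm Gen.am, pderiv_symm Gen.bm]

lemma coeff_zero_symDagger (p : MvPolynomial Gen ℂ) :
    coeff 0 (symDagger p) = starRingEnd ℂ (coeff 0 p) := by
  induction p using MvPolynomial.induction_on with
  | C c => simp [symDagger_C]
  | add p q hp hq => rw [map_add, coeff_add, coeff_add, map_add, hp, hq]
  | mul_X p g hp => rw [map_mul, symDagger_X, coeff_mul_X', coeff_mul_X']; simp

lemma symbol_dagger (ε : ℝ) (w : W ε) : symbol ε (dagger ε w) = symDagger (symbol ε w) := by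
  have h : ∀ u : FreeAlgebra ℂ Gen, ∀ v : W ε,
      symbol ε (dagger ε v) = symDagger (symbol ε v) →
      symbol ε (dagger ε (toW ε u * v)) = symDagger (symbol ε (toW ε u * v)) := by
    intro u
    induction u using FreeAlgebra.induction with
    | grade0 r =>
      intro v hv
      rw [AlgHom.commutes, ← Algebra.smul_def, dagger_smul, map_smul, map_smul, hv,
        symDagger_smul]
    | grade1 g =>
      intro v hv
      change symbol ε (dagger ε (gen ε g * v)) = symDagger (symbol ε (gen ε g * v))
      rw [dagger_mul, dagger_gen, symbol_mul_gen, symbol_gen_mul, hv, opM_apply, opM_apply,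
        map_add, map_mul, symDagger_smul, symDagger_symD, symDagger_X, map_div₀,
        Complex.conj_ofReal, map_ofNat]
      module
    | mul a b ha hb => intro v hv; rw [map_mul (toW ε), mul_assoc]; exact ha _ (hb v hv)
    | add a b ha hb =>
      intro v hv
      rw [map_add, add_mul, dagger_add, map_add, map_add, map_add, ha v hv, hb v hv]
  obtain ⟨u, rfl⟩ := toW_surjective ε w
  have h1 : dagger ε 1 = 1 := by
    have := dagger_algebraMap ε 1
    simpa using this
  simpa using h u 1 (by rw [h1, symbol_one, map_one])

lemma dagger_dagger (ε : ℝ) (w : W ε) : dagger ε (dagger ε w) = w := by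
  apply symbol_injective ε
  rw [symbol_dagger, symbol_dagger]
  induction symbol ε w using MvPolynomial.induction_on with
  | C c => simp [symDagger_C]
  | add p q hp hq => rw [map_add, map_add, hp, hq]
  | mul_X p g hp => rw [map_mul, map_mul, hp, symDagger_X, symDagger_X, conjGen_conjGen]

lemma dagger_sub (ε : ℝ) (v w : W ε) : dagger ε (v - w) = dagger ε v - dagger ε w := by
  simp [dagger]

lemma dagger_mem_Psi {ε : ℝ} {w : W ε} (h : w ∈ Psi ε) : dagger ε w ∈ Psi ε := by
  rw [mem_Psi_iff] at h ⊢
  rw [symbol_dagger, ← symDagger_lap, h, map_zero]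

lemma dagger_K0 (ε : ℝ) : dagger ε (K0 ε) = K0 ε := by
  rw [K0, dagger_smul, dagger_add, dagger_add, dagger_mul, dagger_mul, dagger_algebraMap,
    map_div₀, map_one, map_ofNat]
  simp [dagger_gen, conjGen]

lemma dJm_symDagger (p : MvPolynomial Gen ℂ) : dJm (symDagger p) = -symDagger (dJp p) := by
  rw [dJm_apply, dJp_apply, map_sub, map_mul, map_mul, symDagger_pderiv, symDagger_pderiv,
    symDagger_X, symDagger_X]
  simp only [conjGen]
  ring

lemma dJ0_symDagger (p : MvPolynomial Gen ℂ) : dJ0 (symDagger p) = -symDagger (dJ0 p) := by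
  rw [dJ0_apply, dJ0_apply, symDagger_smul, map_add, map_sub, map_sub]
  simp only [map_mul, symDagger_pderiv, symDagger_X, conjGen, map_div₀, map_one, map_ofNat]
  rw [← smul_neg]
  congr 1
  ring

lemma dK0_symDagger (p : MvPolynomial Gen ℂ) : dK0 (symDagger p) = -symDagger (dK0 p) := by
  rw [dK0_apply, dK0_apply, symDagger_smul, map_sub, map_add, map_sub]
  simp only [map_mul, symDagger_pderiv, symDagger_X, conjGen, map_div₀, map_one, map_ofNat]
  rw [← smul_neg]
  congr 1
  ring

lemma dJp_symDagger (p : MvPolynomial Gen ℂ) : dJp (symDagger p) = -symDagger (dJm p) := by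
  rw [dJm_apply, dJp_apply, map_sub, map_mul, map_mul, symDagger_pderiv, symDagger_pderiv,
    symDagger_X, symDagger_X]
  simp only [conjGen]
  ring

/-! ### The invariant functional -/

/-- The functional `π_0 ∘ ρ_R`. -/
def omega (ε R : ℝ) : W ε →ₗ[ℂ] ℂ :=
  (Finsupp.lapply 0 ∘ₗ (symBasis ε).repr.toLinearMap) ∘ₗ rho ε R

lemma omega_apply (ε R : ℝ) (w : W ε) : omega ε R w = pi0 ε (rho ε R w) := rfl

lemma innerProd_eq_omega (ε R : ℝ) (ξ ζ : W ε) :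
    innerProd ε R ξ ζ = omega ε R (dagger ε ξ * ζ) := rfl

lemma omega_of_mem_Psi {ε R : ℝ} {w : W ε} (h : w ∈ Psi ε) :
    omega ε R w = coeff 0 (symbol ε w) := by
  rw [omega_apply, rho, Submodule.projection_apply_of_mem_left _ h, pi0_eq]

lemma omega_of_mem_kerRho {ε R : ℝ} {w : W ε} (h : w ∈ kerRho ε R) : omega ε R w = 0 := by
  rw [omega_apply, rho, (Submodule.projection_apply_eq_zero_iff _).2 h, pi0_eq, map_zero,
    coeff_zero]

lemma omega_mul_K0 (ε R : ℝ) (w : W ε) :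
    omega ε R (w * K0 ε) = (Rhat ε R : ℂ) * omega ε R w := by
  have h : omega ε R (w * (K0 ε - algebraMap ℂ (W ε) (Rhat ε R : ℂ))) = 0 :=
    omega_of_mem_kerRho ⟨w, rfl⟩
  rw [mul_sub, map_sub, sub_eq_zero, ← Algebra.commutes, ← Algebra.smul_def, map_smul] at h
  exact h

lemma exists_decomposition (ε R : ℝ) (w : W ε) : ∃ ψ ∈ Psi ε, ∃ u : W ε,
    w = ψ + u * (K0 ε - algebraMap ℂ (W ε) (Rhat ε R : ℂ)) := by
  have h : w ∈ Psi ε ⊔ kerRho ε R := by rw [(isCompl_Psi_kerRho ε R).sup_eq_top]; trivial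
  obtain ⟨ψ, hψ, _, ⟨u, rfl⟩, he⟩ := Submodule.mem_sup.1 h
  exact ⟨ψ, hψ, u, he.symm⟩

/-- The functional `π_0 ∘ ρ_R` is invariant under every derivation `(1/ε) Ad T` which preserves
the kernel and the range of the projection `ρ_R` and the absence of a constant term. -/
lemma omega_scaledAd (ε R : ℝ) {T : W ε}
    {D : Derivation ℂ (MvPolynomial Gen ℂ) (MvPolynomial Gen ℂ)}
    (hD : ∀ w, symbol ε (scaledAd ε T w) = D (symbol ε w)) (hl : ∀ p, lap (D p) = D (lap p))
    (h0 : ∀ p, coeff 0 (D p) = 0) (hq : D quadK = 0) (w : W ε) :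
    omega ε R (scaledAd ε T w) = 0 := by
  obtain ⟨ψ, hψ, u, rfl⟩ := exists_decomposition ε R w
  have hK : scaledAd ε T (K0 ε - algebraMap ℂ (W ε) (Rhat ε R : ℂ)) = 0 := by
    apply symbol_injective ε
    have hs : ∃ c : ℂ, symbol ε (K0 ε - algebraMap ℂ (W ε) (Rhat ε R : ℂ))
        = (1 / 2 : ℂ) • quadK + c • 1 := by
      refine ⟨-(Rhat ε R : ℂ), ?_⟩
      rw [K0, Algebra.algebraMap_eq_smul_one, Algebra.algebraMap_eq_smul_one]
      simp only [map_sub, map_smul, map_add, symbol_gen_mul, symbol_gen, symbol_one, opM_apply,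
        symD_X, bracket, quadK, Algebra.algebraMap_eq_smul_one]
      module
    obtain ⟨c, hc⟩ := hs
    rw [hD, hc, map_add, Derivation.map_smul, Derivation.map_smul, hq,
      Derivation.map_one_eq_zero, map_zero, smul_zero, smul_zero, add_zero]
  have h1 : scaledAd ε T ψ ∈ Psi ε := by
    rw [mem_Psi_iff] at hψ ⊢
    rw [hD, hl, hψ, Derivation.map_zero]
  rw [map_add, map_add, omega_of_mem_Psi h1, hD, h0, zero_add, scaledAd_mul, hK, mul_zero,
    add_zero]
  exact omega_of_mem_kerRho ⟨_, rfl⟩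

lemma coeff_zero_sym2 (x y : Gen) (p : MvPolynomial Gen ℂ) : coeff 0 (sym2 x y p) = 0 := by
  rw [sym2_apply, coeff_add, coeff_X_mul', coeff_X_mul']
  simp

lemma omega_scaledAd_J0 (ε R : ℝ) (w : W ε) : omega ε R (scaledAd ε (J0 ε) w) = 0 :=
  omega_scaledAd ε R (symbol_scaledAd_J0 ε) lap_dJ0 (fun p => by
    rw [coeff_dJ0]; simp [weight])
    (by
      rw [dJ0_apply]
      refine (congrArg _ ?_).trans (smul_zero _)
      simp [quadK, Derivation.leibniz, pderiv_X]; ring) w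

lemma omega_scaledAd_K0 (ε R : ℝ) (w : W ε) : omega ε R (scaledAd ε (K0 ε) w) = 0 :=
  omega_scaledAd ε R (symbol_scaledAd_K0 ε) lap_dK0 (fun p => by
    rw [coeff_dK0]; simp [weight])
    (by simp [quadK, dK0_apply, Derivation.leibniz, pderiv_X]; ring) w

lemma omega_scaledAd_Jp (ε R : ℝ) (w : W ε) : omega ε R (scaledAd ε (Jp ε) w) = 0 :=
  omega_scaledAd ε R (symbol_scaledAd_Jp ε) lap_dJp (coeff_zero_sym2 _ _)
    (by simp [quadK, dJp_apply, Derivation.leibniz, pderiv_X]; ring) w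

lemma omega_scaledAd_Jm (ε R : ℝ) (w : W ε) : omega ε R (scaledAd ε (Jm ε) w) = 0 :=
  omega_scaledAd ε R (symbol_scaledAd_Jm ε) lap_dJm (coeff_zero_sym2 _ _)
    (by simp [quadK, dJm_apply, Derivation.leibniz, pderiv_X]; ring) w

lemma omega_K0_mul (ε R : ℝ) (w : W ε) :
    omega ε R (K0 ε * w) = (Rhat ε R : ℂ) * omega ε R w := by
  have h : K0 ε * w = w * K0 ε + Ad ε (K0 ε) w := by rw [Ad_apply]; abel
  rw [h, map_add, omega_mul_K0, Ad_eq_smul_scaledAd, LinearMap.smul_apply, map_smul,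
    omega_scaledAd_K0, smul_zero, add_zero]

/-- Hermiticity of the functional. The kernel of `ρ_R` consists of left multiples of `K_0 - R̂` and
its conjugates are right multiples, on which the functional vanishes by its invariance under
`K_0`. -/
lemma omega_dagger (ε R : ℝ) (w : W ε) :
    omega ε R (dagger ε w) = starRingEnd ℂ (omega ε R w) := by
  obtain ⟨ψ, hψ, u, rfl⟩ := exists_decomposition ε R w
  have hu : omega ε R (u * (K0 ε - algebraMap ℂ (W ε) (Rhat ε R : ℂ))) = 0 :=
    omega_of_mem_kerRho ⟨u, rfl⟩
  rw [dagger_add, dagger_mul, dagger_sub, dagger_K0, dagger_algebraMap, Complex.conj_ofReal,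
    map_add, map_add, sub_mul, map_sub, omega_K0_mul, ← Algebra.smul_def, map_smul, smul_eq_mul,
    sub_self, add_zero, omega_of_mem_Psi (dagger_mem_Psi hψ), symbol_dagger,
    coeff_zero_symDagger, hu, add_zero, omega_of_mem_Psi hψ]

/-! ### Adjoints for the sesquilinear form -/

lemma innerProd_smul_right (ε R : ℝ) (c : ℂ) (ξ ζ : W ε) :
    innerProd ε R ξ (c • ζ) = c * innerProd ε R ξ ζ := by
  rw [innerProd_eq_omega, mul_smul_comm, map_smul, smul_eq_mul, innerProd_eq_omega]

lemma innerProd_smul_left (ε R : ℝ) (c : ℂ) (ξ ζ : W ε) :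
    innerProd ε R (c • ξ) ζ = starRingEnd ℂ c * innerProd ε R ξ ζ := by
  rw [innerProd_eq_omega, dagger_smul, smul_mul_assoc, map_smul, smul_eq_mul, innerProd_eq_omega]

lemma innerProd_self (ε R : ℝ) (ξ : W ε) :
    innerProd ε R ξ ξ = (normSqR ε R ξ : ℂ) := by
  refine (Complex.conj_eq_iff_re.1 ?_).symm
  rw [innerProd_eq_omega, ← omega_dagger, dagger_mul, dagger_dagger]

/-- If the functional is invariant under `(1/ε) Ad T` then `(1/ε) Ad T` and `(1/ε) Ad T†` are
adjoint to each other, since `(1/ε) Ad T` is a derivation. The element `T' = T†` enters only through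
the relation `hd`. -/
lemma innerProd_scaledAd (ε R : ℝ) {T T' : W ε} (hT : ∀ w, omega ε R (scaledAd ε T w) = 0)
    (hd : ∀ w, scaledAd ε T (dagger ε w) + dagger ε (scaledAd ε T' w) = 0) (ξ ζ : W ε) :
    innerProd ε R ξ (scaledAd ε T ζ) = innerProd ε R (scaledAd ε T' ξ) ζ := by
  have h := hT (dagger ε ξ * ζ)
  have h' : omega ε R (scaledAd ε T (dagger ε ξ) * ζ)
      + omega ε R (dagger ε (scaledAd ε T' ξ) * ζ) = 0 := by
    rw [← map_add, ← add_mul, hd, zero_mul, map_zero]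
  rw [scaledAd_mul, map_add] at h
  rw [innerProd_eq_omega, innerProd_eq_omega]
  exact add_left_cancel (h.trans h'.symm)

lemma innerProd_scaledAd_J0 (ε R : ℝ) (ξ ζ : W ε) :
    innerProd ε R ξ (scaledAd ε (J0 ε) ζ) = innerProd ε R (scaledAd ε (J0 ε) ξ) ζ :=
  innerProd_scaledAd ε R (omega_scaledAd_J0 ε R) (fun w => symbol_injective ε (by
    rw [map_add, symbol_scaledAd_J0, symbol_dagger, dJ0_symDagger, symbol_dagger,
      symbol_scaledAd_J0, neg_add_cancel, map_zero])) ξ ζ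

lemma innerProd_scaledAd_K0 (ε R : ℝ) (ξ ζ : W ε) :
    innerProd ε R ξ (scaledAd ε (K0 ε) ζ) = innerProd ε R (scaledAd ε (K0 ε) ξ) ζ :=
  innerProd_scaledAd ε R (omega_scaledAd_K0 ε R) (fun w => symbol_injective ε (by
    rw [map_add, symbol_scaledAd_K0, symbol_dagger, dK0_symDagger, symbol_dagger,
      symbol_scaledAd_K0, neg_add_cancel, map_zero])) ξ ζ

lemma innerProd_scaledAd_Jp (ε R : ℝ) (ξ ζ : W ε) :
    innerProd ε R ξ (scaledAd ε (Jp ε) ζ) = innerProd ε R (scaledAd ε (Jm ε) ξ) ζ :=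
  innerProd_scaledAd ε R (omega_scaledAd_Jp ε R) (fun w => symbol_injective ε (by
    rw [map_add, symbol_scaledAd_Jp, symbol_dagger, dJp_symDagger, symbol_dagger,
      symbol_scaledAd_Jm, neg_add_cancel, map_zero])) ξ ζ

lemma innerProd_scaledAd_Jm (ε R : ℝ) (ξ ζ : W ε) :
    innerProd ε R ξ (scaledAd ε (Jm ε) ζ) = innerProd ε R (scaledAd ε (Jp ε) ξ) ζ :=
  innerProd_scaledAd ε R (omega_scaledAd_Jm ε R) (fun w => symbol_injective ε (by
    rw [map_add, symbol_scaledAd_Jm, symbol_dagger, dJm_symDagger, symbol_dagger,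
      symbol_scaledAd_Jp, neg_add_cancel, map_zero])) ξ ζ

lemma innerProd_add_right (ε R : ℝ) (ξ ζ ζ' : W ε) :
    innerProd ε R ξ (ζ + ζ') = innerProd ε R ξ ζ + innerProd ε R ξ ζ' := by
  simp only [innerProd_eq_omega, mul_add, map_add]

lemma innerProd_add_left (ε R : ℝ) (ξ ξ' ζ : W ε) :
    innerProd ε R (ξ + ξ') ζ = innerProd ε R ξ ζ + innerProd ε R ξ' ζ := by
  simp only [innerProd_eq_omega, dagger_add, add_mul, map_add]

lemma innerProd_scaledCasimir (ε R : ℝ) (ξ ζ : W ε) :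
    innerProd ε R ξ (scaledCasimir ε ζ) = innerProd ε R (scaledCasimir ε ξ) ζ := by
  simp only [scaledCasimir, LinearMap.add_apply, LinearMap.smul_apply, Module.End.mul_apply,
    innerProd_add_right, innerProd_add_left, innerProd_smul_right, innerProd_smul_left,
    innerProd_scaledAd_J0, innerProd_scaledAd_Jp, innerProd_scaledAd_Jm, map_div₀, map_one,
    map_ofNat]

/-- Eigenvectors of a symmetric operator for different real eigenvalues are orthogonal. -/
lemma innerProd_eq_zero_of_eigen {ε R : ℝ} {A : Module.End ℂ (W ε)}
    (hA : ∀ ξ ζ, innerProd ε R ξ (A ζ) = innerProd ε R (A ξ) ζ) {ξ ζ : W ε} {x y : ℝ}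
    (hξ : A ξ = (x : ℂ) • ξ) (hζ : A ζ = (y : ℂ) • ζ) (hxy : x ≠ y) :
    innerProd ε R ξ ζ = 0 := by
  have h := hA ξ ζ
  rw [hξ, hζ, innerProd_smul_left, innerProd_smul_right, Complex.conj_ofReal, ← sub_eq_zero,
    ← sub_mul] at h
  exact (mul_eq_zero.1 h).resolve_left (sub_ne_zero.2 fun h => hxy (by exact_mod_cast h.symm))

lemma innerProd_P (ε R : ℝ) {n₁ r₁ m₁ n₂ r₂ m₂ : ℝ} (h₁ : Admissible n₁ r₁ m₁)
    (h₂ : Admissible n₂ r₂ m₂) : innerProd ε R (P ε n₁ r₁ m₁) (P ε n₂ r₂ m₂) =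
      if n₁ = n₂ ∧ r₁ = r₂ ∧ m₁ = m₂ then (normSqR ε R (P ε n₁ r₁ m₁) : ℂ) else 0 := by
  split_ifs with h
  · obtain ⟨rfl, rfl, rfl⟩ := h
    exact innerProd_self _ _ _
  · by_cases hr : r₁ = r₂
    · by_cases hm : m₁ = m₂
      · have hn : n₁ ≠ n₂ := fun hn => h ⟨hn, hr, hm⟩
        have p₁ : 0 ≤ n₁ := (abs_nonneg _).trans h₁.2.2.2.1
        have p₂ : 0 ≤ n₂ := (abs_nonneg _).trans h₂.2.2.2.1
        refine innerProd_eq_zero_of_eigen (innerProd_scaledCasimir ε R) (scaledCasimir_P ε h₁)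
          (scaledCasimir_P ε h₂) fun he => hn ?_
        have h3 : (n₁ - n₂) * (n₁ + n₂ + 1) = 0 := by linarith
        exact sub_eq_zero.1 ((mul_eq_zero.1 h3).resolve_right (by positivity))
      · exact innerProd_eq_zero_of_eigen (innerProd_scaledAd_J0 ε R) (scaledAd_J0_P ε h₁)
          (scaledAd_J0_P ε h₂) hm
    · exact innerProd_eq_zero_of_eigen (innerProd_scaledAd_K0 ε R) (scaledAd_K0_P ε h₁)
        (scaledAd_K0_P ε h₂) hr

/-- `J_-` and `J_+` being adjoint, the ladder equations give the same norm to all members of a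
multiplet. -/
lemma normSqR_P_sub_one (ε R : ℝ) {n r m : ℝ} (h : Admissible n r m) (h' : Admissible n r (m - 1)) :
    normSqR ε R (P ε n r (m - 1)) = normSqR ε R (P ε n r m) := by
  have hm := (abs_le.1 h.2.2.2.2).2
  have hm' := (abs_le.1 h'.2.2.2.2).1
  have e := innerProd_scaledAd_Jm ε R (P ε n r (m - 1)) (P ε n r m)
  have e1 : n - (m - 1) = n - m + 1 := by ring
  have e2 : n + (m - 1) + 1 = n + m := by ring
  rw [scaledAd_Jm_P ε h, scaledAd_Jp_P ε h', innerProd_smul_left, innerProd_smul_right,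
    sub_add_cancel, innerProd_self, innerProd_self, Complex.conj_ofReal, e1, e2] at e
  have e3 : Real.sqrt (n + m) * Real.sqrt (n - m + 1) ≠ 0 :=
    mul_ne_zero (Real.sqrt_pos.2 (by linarith)).ne' (Real.sqrt_pos.2 (by linarith)).ne'
  rw [mul_comm (Real.sqrt (n - m + 1))] at e
  exact mul_left_cancel₀ e3 (by exact_mod_cast e)

lemma normSqR_P_eq (ε R : ℝ) {n r m m' : ℝ} (h : Admissible n r m) (h' : Admissible n r m') :
    normSqR ε R (P ε n r m) = normSqR ε R (P ε n r m') := by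
  have key : ∀ {m : ℝ}, Admissible n r m → normSqR ε R (P ε n r m) = normSqR ε R (P ε n r n) := by
    intro m h
    obtain ⟨i, j, k, hk, rfl, rfl, rfl⟩ := admissible_iff.1 h
    clear h h'
    induction k with
    | zero => simp
    | succ k ih =>
      have e : ((i : ℝ) + j) / 2 - (k + 1 : ℕ) = ((i : ℝ) + j) / 2 - k - 1 := by push_cast; ring
      rw [← ih (by omega), e]
      refine normSqR_P_sub_one ε R (admissible_iff.2 ⟨i, j, k, by omega, rfl, rfl, rfl⟩)
        (admissible_iff.2 ⟨i, j, k + 1, hk, rfl, rfl, e.symm⟩)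
  rw [key h, key h']

/-! ### Norms of low degree -/

lemma one_mem_Psi (ε : ℝ) : (1 : W ε) ∈ Psi ε := by
  rw [mem_Psi_iff, symbol_one, lap_apply]
  simp

lemma omega_one (ε R : ℝ) : omega ε R 1 = 1 := by
  rw [omega_of_mem_Psi (one_mem_Psi ε), symbol_one]
  simp

lemma omega_K0 (ε R : ℝ) : omega ε R (K0 ε) = Rhat ε R := by
  have := omega_mul_K0 ε R 1
  rwa [one_mul, omega_one, mul_one] at this

lemma omega_J0 (ε R : ℝ) : omega ε R (J0 ε) = 0 := by
  have h : scaledAd ε (Jp ε) (Jm ε) = (2 : ℂ) • J0 ε := by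
    apply symbol_injective ε
    rw [symbol_scaledAd_Jp, map_smul, J0, Jm, map_smul, map_sub]
    simp only [symbol_gen_mul, symbol_gen, opM_apply, symD_X, dJp_apply, bracket]
    simp [Derivation.leibniz, pderiv_X]
    ring
  have h1 := omega_scaledAd_Jp ε R (Jm ε)
  rw [h, map_smul] at h1
  exact (smul_eq_zero.1 h1).resolve_left two_ne_zero

lemma am_mul_ap (ε : ℝ) : gen ε Gen.am * gen ε Gen.ap
    = gen ε Gen.ap * gen ε Gen.am + (ε : ℂ) • (1 : W ε) := by
  have h := gen_comm ε Gen.am Gen.ap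
  rw [bracket, mul_one, Algebra.algebraMap_eq_smul_one, sub_eq_iff_eq_add] at h
  rw [h, add_comm]

lemma bm_mul_bp (ε : ℝ) : gen ε Gen.bm * gen ε Gen.bp
    = gen ε Gen.bp * gen ε Gen.bm + (ε : ℂ) • (1 : W ε) := by
  have h := gen_comm ε Gen.bm Gen.bp
  rw [bracket, mul_one, Algebra.algebraMap_eq_smul_one, sub_eq_iff_eq_add] at h
  rw [h, add_comm]

lemma omega_am_mul_ap (ε R : ℝ) :
    omega ε R (gen ε Gen.am * gen ε Gen.ap) = Rhat ε R + ε / 2 := by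
  have h : gen ε Gen.am * gen ε Gen.ap = K0 ε + J0 ε + (ε / 2 : ℂ) • (1 : W ε) := by
    rw [am_mul_ap, K0, J0, Algebra.algebraMap_eq_smul_one]
    module
  rw [h, map_add, map_add, map_smul, omega_K0, omega_J0, omega_one, smul_eq_mul, mul_one,
    add_zero]

lemma K0_mul_ap (ε : ℝ) :
    K0 ε * gen ε Gen.ap = gen ε Gen.ap * K0 ε + (ε / 2 : ℂ) • gen ε Gen.ap := by
  have h : Ad ε (K0 ε) (gen ε Gen.ap) = (ε / 2 : ℂ) • gen ε Gen.ap := by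
    rw [Ad_eq_smul_scaledAd]
    apply symbol_injective ε
    rw [LinearMap.smul_apply, map_smul, map_smul, symbol_scaledAd_K0, symbol_gen, dK0_apply]
    simp [pderiv_X, smul_smul, div_eq_mul_inv]
  rw [← h, Ad_apply]
  abel

/-- Insertion of `2 K_0 + ε = a_- a_+ + b_- b_+` between `a_-` and `a_+` relates the squared
norms of `a_+ a_+` and `a_+ b_+`, two members of one multiplet. -/
lemma omega_add_omega (ε R : ℝ) :
    omega ε R (dagger ε (gen ε Gen.ap * gen ε Gen.ap) * (gen ε Gen.ap * gen ε Gen.ap))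
      + omega ε R (dagger ε (gen ε Gen.ap * gen ε Gen.bp) * (gen ε Gen.ap * gen ε Gen.bp))
      = (2 * Rhat ε R + 2 * ε) * (Rhat ε R + ε / 2) := by
  have h1 : gen ε Gen.ap * gen ε Gen.bp = gen ε Gen.bp * gen ε Gen.ap := by
    have h := gen_comm ε Gen.ap Gen.bp
    simpa [bracket, sub_eq_zero] using h
  have h3 : gen ε Gen.am * gen ε Gen.ap + gen ε Gen.bm * gen ε Gen.bp
      = (2 : ℂ) • K0 ε + (ε : ℂ) • (1 : W ε) := by
    rw [am_mul_ap, bm_mul_bp, K0, Algebra.algebraMap_eq_smul_one]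
    module
  have h4 : dagger ε (gen ε Gen.ap * gen ε Gen.ap) * (gen ε Gen.ap * gen ε Gen.ap)
      + dagger ε (gen ε Gen.ap * gen ε Gen.bp) * (gen ε Gen.ap * gen ε Gen.bp)
      = (2 : ℂ) • (gen ε Gen.am * gen ε Gen.ap * K0 ε)
        + (2 * ε : ℂ) • (gen ε Gen.am * gen ε Gen.ap) := by
    calc _ = gen ε Gen.am * ((gen ε Gen.am * gen ε Gen.ap + gen ε Gen.bm * gen ε Gen.bp)
            * gen ε Gen.ap) := by
          rw [h1]
          simp only [dagger_mul, dagger_gen, conjGen, mul_add, add_mul, mul_assoc]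
      _ = _ := by
          rw [h3, add_mul, smul_mul_assoc, smul_mul_assoc, one_mul, K0_mul_ap]
          simp only [mul_add, mul_smul_comm, smul_add, mul_assoc]
          module
  rw [← map_add, h4, map_add, map_smul, map_smul, omega_mul_K0, omega_am_mul_ap, smul_eq_mul,
    smul_eq_mul]
  ring

lemma P_zero (ε : ℝ) : P ε 0 0 0 = 1 := by
  simp [P]

lemma normSqR_P_zero (ε R : ℝ) : normSqR ε R (P ε 0 0 0) = 1 := by
  rw [P_zero, normSqR, innerProd_eq_omega, mul_one]
  have : dagger ε 1 = 1 := by simpa using dagger_algebraMap ε 1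
  rw [this, omega_one, Complex.one_re]

lemma normSqR_P_half (ε R : ℝ) :
    normSqR ε R (P ε (1 / 2) (1 / 2) (1 / 2)) = Rhat ε R + ε / 2 := by
  have h : P ε (1 / 2) (1 / 2) (1 / 2) = gen ε Gen.ap := by
    apply symbol_injective ε
    have := symbol_P ε (show 0 ≤ 1 + 0 by omega)
    norm_num [normCoeff, ladder] at this
    rw [symbol_gen, ← this]
  have h2 : innerProd ε R (P ε (1 / 2) (1 / 2) (1 / 2)) (P ε (1 / 2) (1 / 2) (1 / 2))
      = ((Rhat ε R + ε / 2 : ℝ) : ℂ) := by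
    rw [h, innerProd_eq_omega, dagger_gen, conjGen, omega_am_mul_ap]
    push_cast
    rfl
  rw [normSqR, h2, Complex.ofReal_re]

lemma P_one_one_one (ε : ℝ) : P ε 1 1 1 = gen ε Gen.ap * gen ε Gen.ap := by
  apply symbol_injective ε
  have := symbol_P ε (show 0 ≤ 2 + 0 by omega)
  norm_num [normCoeff, ladder] at this
  rw [this, symbol_gen_mul, symbol_gen, opM_apply, symD_X]
  simp [bracket, sq]

lemma P_one_one_zero (ε : ℝ) :
    P ε 1 1 0 = (Real.sqrt 2 : ℂ) • (gen ε Gen.ap * gen ε Gen.bp) := by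
  apply symbol_injective ε
  have h := symbol_P ε (show 1 ≤ 2 + 0 by omega)
  have e : normCoeff (2 + 0) 1 * 2 = Real.sqrt 2 := by
    have h1 : normCoeff (2 + 0) 1 = Real.sqrt (1 / 2) := by norm_num [normCoeff]
    have h2 : Real.sqrt 2 = Real.sqrt (1 / 2 * (2 * 2)) := by norm_num
    rw [h1, h2, Real.sqrt_mul (by norm_num), Real.sqrt_mul_self (by norm_num)]
  have hl : ladder 2 0 1 = (2 : ℂ) • (X Gen.ap * X Gen.bp) := by
    rw [ladder_succ, ladder, dJm_apply]
    simp [Derivation.leibniz_pow, pderiv_X, ofNat_smul_eq_nsmul]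
    ring
  have e1 : (((2 : ℕ) : ℝ) + (0 : ℕ)) / 2 = 1 := by norm_num
  have e2 : (((2 : ℕ) : ℝ) - (0 : ℕ)) / 2 = 1 := by norm_num
  have e3 : (1 : ℝ) - (1 : ℕ) = 0 := by norm_num
  rw [e1, e2, e3, hl, smul_smul] at h
  rw [h, map_smul, symbol_gen_mul, symbol_gen, opM_apply, symD_X, ← e]
  simp [bracket]

lemma normSqR_P_one (ε R : ℝ) :
    normSqR ε R (P ε 1 1 1) = 4 / 3 * (Rhat ε R + ε) * (Rhat ε R + ε / 2) := by
  have a0 : Admissible 1 1 0 := admissible_iff.2 ⟨2, 0, 1, by omega, by norm_num⟩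
  have a1 : Admissible 1 1 1 := admissible_iff.2 ⟨2, 0, 0, by omega, by norm_num⟩
  have h1 := innerProd_self ε R (P ε 1 1 1)
  have h0 := innerProd_self ε R (P ε 1 1 0)
  rw [normSqR_P_eq ε R a0 a1] at h0
  rw [P_one_one_zero, innerProd_smul_left, innerProd_smul_right, Complex.conj_ofReal,
    innerProd_eq_omega, ← mul_assoc, ← Complex.ofReal_mul, Real.mul_self_sqrt (by norm_num)] at h0
  nth_rewrite 1 2 [P_one_one_one] at h1
  rw [innerProd_eq_omega] at h1
  have h := omega_add_omega ε R
  rw [h1] at h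
  have h2 : (3 : ℂ) * (normSqR ε R (P ε 1 1 1) : ℂ)
      = 2 * ((2 * Rhat ε R + 2 * ε) * (Rhat ε R + ε / 2)) := by
    rw [← h]
    push_cast at h0
    linear_combination -h0
  have h3 : 3 * normSqR ε R (P ε 1 1 1)
      = 2 * ((2 * Rhat ε R + 2 * ε) * (Rhat ε R + ε / 2)) := by exact_mod_cast h2
  linarith

end FuzzySphere

end

open FuzzySphere
theorem mainTheorem1 :
    -- the elements `P(n, r, m)` form a basis of `Ψ`
    (∀ ε : ℝ, ∃ b : Module.Basis Label ℂ (Psi ε),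
      ∀ i : Label, (b i : W ε) = P ε i.1.1 i.1.2.1 i.1.2.2) ∧
    -- for each `n` they form a basis of `Ψ^n`
    (∀ ε n : ℝ, (∃ k : ℕ, 2 * n = k) →
      ∃ b : Module.Basis {i : ℝ × ℝ // Admissible n i.1 i.2} ℂ (PsiDeg ε n),
        ∀ i, (b i : W ε) = P ε n i.1.1 i.1.2) ∧
    -- written in the symmetric polynomials `S(s)`, they do not depend on `ε`
    (∀ ε ε' n r m : ℝ, Admissible n r m →
      (symBasis ε).repr (P ε n r m) = (symBasis ε').repr (P ε' n r m)) ∧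
    -- orthogonality, and the norm is independent of `m`
    (∀ ε R : ℝ, 0 ≤ R → 0 < Rhat ε R →
      (∀ n₁ r₁ m₁ n₂ r₂ m₂ : ℝ, Admissible n₁ r₁ m₁ → Admissible n₂ r₂ m₂ →
        innerProd ε R (P ε n₁ r₁ m₁) (P ε n₂ r₂ m₂) =
          if n₁ = n₂ ∧ r₁ = r₂ ∧ m₁ = m₂ then (normSqR ε R (P ε n₁ r₁ m₁) : ℂ) else 0) ∧
      (∀ n r m m' : ℝ, Admissible n r m → Admissible n r m' →
        normSqR ε R (P ε n r m) = normSqR ε R (P ε n r m'))) ∧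
    -- the norm may be positive, negative or zero
    (∃ ε R n r m : ℝ, 0 ≤ R ∧ 0 < Rhat ε R ∧ Admissible n r m ∧ 0 < normSqR ε R (P ε n r m)) ∧
    (∃ ε R n r m : ℝ, 0 ≤ R ∧ 0 < Rhat ε R ∧ Admissible n r m ∧ normSqR ε R (P ε n r m) < 0) ∧
    (∃ ε R n r m : ℝ, 0 ≤ R ∧ 0 < Rhat ε R ∧ Admissible n r m ∧ normSqR ε R (P ε n r m) = 0) ∧
    -- eigenvalue equations and ladder operators
    (∀ ε n r m : ℝ, Admissible n r m →
      Ad ε (J0 ε) (P ε n r m) = ((ε * m : ℝ) : ℂ) • P ε n r m ∧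
      casimir ε (P ε n r m) = ((ε ^ 2 * (n * (n + 1)) : ℝ) : ℂ) • P ε n r m ∧
      Ad ε (K0 ε) (P ε n r m) = ((ε * r : ℝ) : ℂ) • P ε n r m ∧
      Ad ε (Jp ε) (P ε n r m) =
        ((ε * Real.sqrt (n - m) * Real.sqrt (n + m + 1) : ℝ) : ℂ) • P ε n r (m + 1) ∧
      Ad ε (Jm ε) (P ε n r m) =
        ((ε * Real.sqrt (n + m) * Real.sqrt (n - m + 1) : ℝ) : ℂ) • P ε n r (m - 1)) ∧
    -- the same equations divided by `ε`, with their limits at `ε = 0`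
    (∀ ε n r m : ℝ, Admissible n r m →
      scaledAd ε (J0 ε) (P ε n r m) = (m : ℂ) • P ε n r m ∧
      scaledCasimir ε (P ε n r m) = ((n * (n + 1) : ℝ) : ℂ) • P ε n r m ∧
      scaledAd ε (K0 ε) (P ε n r m) = (r : ℂ) • P ε n r m ∧
      scaledAd ε (Jp ε) (P ε n r m) =
        ((Real.sqrt (n - m) * Real.sqrt (n + m + 1) : ℝ) : ℂ) • P ε n r (m + 1) ∧
      scaledAd ε (Jm ε) (P ε n r m) =
        ((Real.sqrt (n + m) * Real.sqrt (n - m + 1) : ℝ) : ℂ) • P ε n r (m - 1)) ∧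
    -- the joint eigenspaces
    (∀ ε n r m : ℝ, Admissible n r m →
      PsiDeg ε n ⊓ PsiK ε r ⊓ PsiJ ε m = Submodule.span ℂ {P ε n r m} ∧
      Module.finrank ℂ ↥(PsiDeg ε n ⊓ PsiK ε r ⊓ PsiJ ε m) = 1) ∧
    (∀ ε n r m : ℝ, ¬ Admissible n r m → PsiDeg ε n ⊓ PsiK ε r ⊓ PsiJ ε m = ⊥) := by
  refine ⟨fun ε => ?_, fun ε n hn => ?_, fun ε ε' n r m h => ?_, fun ε R _ _ => ⟨?_, ?_⟩,
    ?_, ?_, ?_, fun ε n r m h => ?_, fun ε n r m h => ?_, fun ε n r m h => ?_,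
    fun ε n r m h => joint_eq_bot ε h⟩
  · exact exists_basis_P ε (fun i : Label => i.1) Subtype.val_injective (fun i => i.2) (Psi ε)
      le_rfl (fun i => P_mem_Psi ε i.2) fun w _ d _ => ⟨⟨weight d, admissible_weight d⟩, rfl⟩
  · refine exists_basis_P ε (fun i : {i : ℝ × ℝ // Admissible n i.1 i.2} => (n, i.1)) ?_
      (fun i => i.2) (PsiDeg ε n) inf_le_left (fun i => P_mem_PsiDeg ε i.2) fun w hw d hd => ?_
    · intro i j hij
      exact Subtype.ext (Prod.ext_iff.1 hij).2
    · have h1 := mem_Wn_iff.1 hw.2 d hd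
      have h2 := admissible_weight d
      rw [h1] at h2
      exact ⟨⟨(weight d).2, h2⟩, Prod.ext h1.symm rfl⟩
  · exact repr_eq_of_symbol_eq (symbol_P_eq ε ε' h)
  · exact fun _ _ _ _ _ _ h₁ h₂ => innerProd_P ε R h₁ h₂
  · exact fun _ _ _ _ h h' => normSqR_P_eq ε R h h'
  · refine ⟨0, 1, 0, 0, 0, by norm_num, by norm_num [Rhat],
      admissible_iff.2 ⟨0, 0, 0, by omega, by norm_num⟩, ?_⟩
    rw [normSqR_P_zero]
    norm_num
  · -- `R` is chosen such that `R̂ = 3/2` lies between `|ε| / 2` and `|ε|`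
    have hR : Rhat (-2) (Real.sqrt 5 / 2) = 3 / 2 := by
      rw [Rhat, div_pow, Real.sq_sqrt (by norm_num),
        show (5 : ℝ) / 2 ^ 2 + (-2) ^ 2 / 4 = (3 / 2) ^ 2 by norm_num, Real.sqrt_sq (by norm_num)]
    refine ⟨-2, Real.sqrt 5 / 2, 1, 1, 1, by positivity, by rw [hR]; norm_num,
      admissible_iff.2 ⟨2, 0, 0, by omega, by norm_num⟩, ?_⟩
    rw [normSqR_P_one, hR]
    norm_num
  · -- for `R = 0` and `ε < 0` the norm of `a_+` is `|ε| / 2 + ε / 2 = 0`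
    have hR : Rhat (-2) 0 = 1 := by norm_num [Rhat]
    refine ⟨-2, 0, 1 / 2, 1 / 2, 1 / 2, le_rfl, by rw [hR]; norm_num,
      admissible_iff.2 ⟨1, 0, 0, by omega, by norm_num⟩, ?_⟩
    rw [normSqR_P_half, hR]
    norm_num
  · simp only [Ad_eq_smul_scaledAd, casimir_eq, LinearMap.smul_apply, scaledAd_J0_P ε h,
      scaledAd_K0_P ε h, scaledCasimir_P ε h, scaledAd_Jp_P ε h, scaledAd_Jm_P ε h, smul_smul,
      ← Complex.ofReal_mul, ← Complex.ofReal_pow, mul_assoc, and_self]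
  · exact ⟨scaledAd_J0_P ε h, scaledCasimir_P ε h, scaledAd_K0_P ε h, scaledAd_Jp_P ε h,
      scaledAd_Jm_P ε h⟩
  · exact ⟨joint_eq_span ε h, finrank_joint ε h⟩
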